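/- Let $m,l\ge 0$, let $g_1,\dots,g_l:\mathbb{R}^m\to\mathbb{R}$ be convex and twice continuously differentiable, $\Gamma=\{y\in\mathbb{R}^m\mid g_i(y)\le 0,\ i=1,\dots,l\}$, and let $Q=\widehat N_\Gamma$ be the (regular) normal cone mapping, i.e. $Q(y)$ is the polar cone of the Bouligand tangent cone $T_\Gamma(y)$ for $y\in\Gamma$ and $Q(y)=\emptyset$ otherwise. Let $\bar y^*\in Q(\bar y)$ and let $I(\bar y)=\{i\mid g_i(\bar y)=0\}$. Assume that at $\bar y$ the following hold: (MFCQ) there is $d$ with $\nabla g_i(\bar y)d<0$ for all $i\in I(\bar y)$; (CRCQ) for every $J\subset I(\bar y)$ the rank of $\{\nabla g_i(y)\mid i\in J\}$ is constant for $y$ near $\bar y$. Let $\bar\lambda\in\mathbb{R}^l$ be any multiplier: $\bar y^*=\sum_i\bar\lambda_i\nabla g_i(\bar y)^T$, $\bar\lambda\ge 0$, $\langle\bar\lambda,g(\bar y)\rangle=0$. Put $$A=\sum_{i=1}^l\bar\lambda_i\nabla^2g_i(\bar y),\quad E=\{z\mid\nabla g_i(\bar y)z=0,\ i\in I(\bar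 y)\},\quad M=E\times E^\perp,\quad L=\{(h,k)\in\mathbb{R}^m\times\mathbb{R}^m\mid(h,k-Ah)\in M\}.$$ Notation: $\mathcal{Z}_{nm}$ is the set of $n$-dimensional subspaces of $\mathbb{R}^n\times\mathbb{R}^m$ with the metric $d(L_1,L_2)=\|P_1-P_2\|$, where $P_i$ is the orthogonal projection onto $L_i$. The adjoint of a subspace $L$ is $L^*=\{(-v^*,u^*)\mid(u^*,v^*)\in L^\perp\}$. For $F:\mathbb{R}^n\rightrightarrows\mathbb{R}^m$, $\mathcal{S}F(x,y)$ is the set of all $L\in\mathcal{Z}_{nm}$ for which there are $(x_k,y_k)\in\mathrm{gph}\,F$ converging to $(x,y)$ such that $T_{\mathrm{gph}F}(x_k,y_k)\in\mathcal{Z}_{nm}$ for all $k$ and $d(L,T_{\mathrm{gph}F}(x_k,y_k))\to0$; further $\mathcal{S}^*F(x,y)=\{L^*\mid L\in\mathcal{S}F(x,y)\}$. A pair $(B,C)$ of matrices in $\mathbb{R}^{m\times m}$ is a basis of an $m$-dimensional subspace $K$ of $\mathbb{R}^m\times\mathbb{R}^m$ if $K=\mathrm{rge}(B,C):=\{(Bp,Cp)\mid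 p\in\mathbb{R}^m\}$ (so that the columns of the stacked matrix are linearly independent). Then $M\in\mathcal{Z}_{mm}$ and $$L=L^*\in\mathcal{S}Q(\bar y,\bar y^*)=\mathcal{S}^*Q(\bar y,\bar y^*).$$ Moreover, let $D$ be the $m\times|I(\bar y)|$ matrix with columns $\nabla g_i(\bar y)^T/\|\nabla g_i(\bar y)\|$, $i\in I(\bar y)$, and $s=\mathrm{rank}\,D$. There is a QR factorization $$DP=(Q_1\,\vdots\,Q_2)\begin{pmatrix}R_{11}&R_{12}\\0&0\end{pmatrix}$$ with a permutation matrix $P$, an orthogonal matrix $(Q_1\,\vdots\,Q_2)$, $Q_1\in\mathbb{R}^{m\times s}$, $Q_2\in\mathbb{R}^{m\times(m-s)}$, and a nonsingular upper triangular matrix $R_{11}\in\mathbb{R}^{s\times s}$. For every such factorization, $((Q_2\,\vdots\,0),(0\,\vdots\,Q_1))$ is a basis of $M$, and $(Z^*,Y^*)$ with $$Z^*=(Q_2\,\vdots\,0),\qquad Y^*=(AQ_2\,\vdots\,Q_1)$$ is a basis of $L^*$. -/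

import Mathlib

open Filter Topology Set
open scoped Gradient

noncomputable section

namespace SCD

/-! ### Euclidean spaces, subspaces of `ℝⁿ × ℝᵐ`, bases, adjoint subspaces -/

/-- `ℝⁿ` with the Euclidean norm. -/
abbrev Vec (n : ℕ) : Type := EuclideanSpace ℝ (Fin n)

/-- `ℝⁿ × ℝᵐ`, identified with `ℝⁿ⁺ᵐ`: the norm and the inner product are the Euclidean ones. -/
abbrev Pair (n m : ℕ) : Type := WithLp 2 (Vec n × Vec m)

/-- The element `(u, v)` of `ℝⁿ × ℝᵐ`. -/
abbrev pair {n m : ℕ} (u : Vec n) (v : Vec m) : Pair n m := WithLp.toLp 2 (u, v)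

/-- The set of all `n`-dimensional subspaces of `ℝⁿ × ℝᵐ`. -/
def Z (n m : ℕ) : Set (Submodule ℝ (Pair n m)) := {L | Module.finrank ℝ L = n}

/-- The distance of two subspaces: the (spectral) norm of the difference of the orthogonal
projections onto them. -/
def subspaceDist {n m : ℕ} (L₁ L₂ : Submodule ℝ (Pair n m)) : ℝ :=
  ‖L₁.starProjection - L₂.starProjection‖

/-- The linear map `S_{nm} : (u, v) ↦ (-v, u)` from `ℝⁿ × ℝᵐ` to `ℝᵐ × ℝⁿ`. -/
def swapNeg (n m : ℕ) : Pair n m →ₗ[ℝ] Pair m n where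
  toFun p := pair (-p.snd) p.fst
  map_add' p q := by
    simp only [WithLp.add_fst, WithLp.add_snd, neg_add]
    rfl
  map_smul' c p := by
    simp only [WithLp.smul_fst, WithLp.smul_snd, ← smul_neg, RingHom.id_apply]
    rfl

/-- The adjoint subspace `L* = {(-v*, u*) | (u*, v*) ∈ Lᗮ}`. -/
def adjoint {n m : ℕ} (L : Submodule ℝ (Pair n m)) : Submodule ℝ (Pair m n) :=
  Lᗮ.map (swapNeg n m)

/-- The product `U × W` of two subspaces, as a subspace of `ℝⁿ × ℝᵐ`. -/
def prodSubspace {n m : ℕ} (U : Submodule ℝ (Vec n)) (W : Submodule ℝ (Vec m)) :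
    Submodule ℝ (Pair n m) :=
  (U.prod W).comap (WithLp.linearEquiv 2 ℝ (Vec n × Vec m)).toLinearMap

/-- The linear map `p ↦ (B p, C p)` for matrices `B`, `C` with the same columns index. -/
def stackMap {n m : ℕ} {κ : Type*} [Fintype κ] [DecidableEq κ]
    (B : Matrix (Fin n) κ ℝ) (C : Matrix (Fin m) κ ℝ) : EuclideanSpace ℝ κ →ₗ[ℝ] Pair n m :=
  (WithLp.linearEquiv 2 ℝ (Vec n × Vec m)).symm.toLinearMap ∘ₗ
    (Matrix.toEuclideanLin B).prod (Matrix.toEuclideanLin C)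

/-- `rge (B, C) = {(B p, C p) | p}`. -/
def rge {n m : ℕ} {κ : Type*} [Fintype κ] [DecidableEq κ]
    (B : Matrix (Fin n) κ ℝ) (C : Matrix (Fin m) κ ℝ) : Submodule ℝ (Pair n m) :=
  LinearMap.range (stackMap B C)

/-- `(B, C)` is a basis of the `n`-dimensional subspace `L` of `ℝⁿ × ℝᵐ`: `B` and `C` have `n`
columns, the columns of the stacked matrix are linearly independent, and `L = rge (B, C)`. -/
def IsBasisOf {n m : ℕ} {κ : Type*} [Fintype κ] [DecidableEq κ]
    (B : Matrix (Fin n) κ ℝ) (C : Matrix (Fin m) κ ℝ) (L : Submodule ℝ (Pair n m)) : Prop :=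
  Fintype.card κ = n ∧ Function.Injective (stackMap B C) ∧ L = rge B C

/-! ### SC derivatives of set-valued mappings -/

/-- The graph of the set-valued mapping `F : ℝⁿ ⇉ ℝᵐ`. -/
def gph {n m : ℕ} (F : Vec n → Set (Vec m)) : Set (Pair n m) := {p | p.snd ∈ F p.fst}

/-- `p` is a point of the graph of `F` whose tangent (Bouligand) cone is the `n`-dimensional
subspace `L`. -/
def IsSmoothPoint {n m : ℕ} (F : Vec n → Set (Vec m)) (p : Pair n m)
    (L : Submodule ℝ (Pair n m)) : Prop :=
  p ∈ gph F ∧ L ∈ Z n m ∧ posTangentConeAt (gph F) p = (L : Set (Pair n m))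

/-- The SC derivative `𝒮F(x, y)`: all limits in `Z n m` of the tangent spaces at points
`(xₖ, yₖ) → (x, y)` of the graph where `F` is graphically smooth of dimension `n`. -/
def SC {n m : ℕ} (F : Vec n → Set (Vec m)) (x : Vec n) (y : Vec m) :
    Set (Submodule ℝ (Pair n m)) :=
  {L | L ∈ Z n m ∧ ∃ (p : ℕ → Pair n m) (T : ℕ → Submodule ℝ (Pair n m)),
    (∀ k, IsSmoothPoint F (p k) (T k)) ∧ Tendsto p atTop (𝓝 (pair x y)) ∧
    Tendsto (fun k => subspaceDist L (T k)) atTop (𝓝 0)}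

/-- The adjoint SC derivative `𝒮*F(x, y) = {L* | L ∈ 𝒮F(x, y)}`. -/
def SCstar {n m : ℕ} (F : Vec n → Set (Vec m)) (x : Vec n) (y : Vec m) :
    Set (Submodule ℝ (Pair m n)) :=
  adjoint '' SC F x y

/-- The regular normal cone mapping: the polar cone of the tangent (Bouligand) cone to `A` at
`y` for `y ∈ A`, and the empty set for `y ∉ A`. -/
def regularNormalCone {m : ℕ} (A : Set (Vec m)) (y : Vec m) : Set (Vec m) :=
  {v | y ∈ A ∧ ∀ w ∈ posTangentConeAt A y, inner ℝ v w ≤ 0}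

/-! ### Inequality systems -/

/-- `{y | gᵢ(y) ≤ 0 for all i}`. -/
def feasibleSet {m l : ℕ} (g : Fin l → Vec m → ℝ) : Set (Vec m) := {y | ∀ i, g i y ≤ 0}

/-- The indices of the constraints that are active at `y`. -/
def active {m l : ℕ} (g : Fin l → Vec m → ℝ) (y : Vec m) : Finset (Fin l) :=
  Finset.univ.filter fun i => g i y = 0

/-- The Mangasarian-Fromovitz constraint qualification at `y`. -/
def MFCQ {m l : ℕ} (g : Fin l → Vec m → ℝ) (y : Vec m) : Prop :=
  ∃ d : Vec m, ∀ i ∈ active g y, inner ℝ (∇ (g i) y) d < 0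

/-- The constant rank constraint qualification at `y`: for every set `J` of active indices the
rank of the gradients with index in `J` is constant near `y`. -/
def CRCQ {m l : ℕ} (g : Fin l → Vec m → ℝ) (y : Vec m) : Prop :=
  ∀ J ⊆ active g y, ∀ᶠ z in 𝓝 y,
    Set.finrank ℝ ((fun i => ∇ (g i) z) '' (J : Set (Fin l))) =
      Set.finrank ℝ ((fun i => ∇ (g i) y) '' (J : Set (Fin l)))

/-- `lam` is a Lagrange multiplier for `ystar` at `y`. -/
def IsMultiplier {m l : ℕ} (g : Fin l → Vec m → ℝ) (y ystar : Vec m) (lam : Fin l → ℝ) : Prop :=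
  ystar = ∑ i, lam i • ∇ (g i) y ∧ (∀ i, 0 ≤ lam i) ∧ ∑ i, lam i * g i y = 0

/-- The Hessian matrix of `f` at `y`. -/
def hessian {m : ℕ} (f : Vec m → ℝ) (y : Vec m) : Matrix (Fin m) (Fin m) ℝ :=
  Matrix.of fun i j =>
    fderiv ℝ (fderiv ℝ f) y (EuclideanSpace.single i 1) (EuclideanSpace.single j 1)

/-- The matrix `∑ lamᵢ ∇²gᵢ(y)`. -/
def hessianSum {m l : ℕ} (g : Fin l → Vec m → ℝ) (y : Vec m) (lam : Fin l → ℝ) :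
    Matrix (Fin m) (Fin m) ℝ :=
  ∑ i, lam i • hessian (g i) y

/-- The subspace `E = {z | ∇gᵢ(y) z = 0 for all active i}`. -/
def activeKernel {m l : ℕ} (g : Fin l → Vec m → ℝ) (y : Vec m) : Submodule ℝ (Vec m) :=
  ⨅ i ∈ active g y, LinearMap.ker (fderiv ℝ (g i) y).toLinearMap

/-- The linear map `(h, k) ↦ (h, k - A h)`. -/
def shear {m : ℕ} (A : Matrix (Fin m) (Fin m) ℝ) : Pair m m →ₗ[ℝ] Pair m m where
  toFun p := pair p.fst (p.snd - Matrix.toEuclideanLin A p.fst)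
  map_add' p q := by
    simp only [WithLp.add_fst, WithLp.add_snd, map_add, add_sub_add_comm]
    rfl
  map_smul' c p := by
    simp only [WithLp.smul_fst, WithLp.smul_snd, map_smul, ← smul_sub, RingHom.id_apply]
    rfl

/-- The matrix whose columns are the normalized active gradients. -/
def activeMatrix {m l : ℕ} (g : Fin l → Vec m → ℝ) (y : Vec m) :
    Matrix (Fin m) (active g y) ℝ :=
  Matrix.of fun j i => ∇ (g i) y j / ‖∇ (g i) y‖

/-- `Q = (Q₁ ⋮ Q₂)` is the orthogonal factor, and `s = rank D`, in a full QR factorization with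
column pivoting `D P = Q (R₁₁ R₁₂; 0 0)`: `P` permutes the columns (here, a bijection `σ` orders
them), `Q` is orthogonal, and `R₁₁` is upper triangular and nonsingular. -/
def IsPivotedQR {m : ℕ} {ι : Type*} [Fintype ι] (D : Matrix (Fin m) ι ℝ) (s : ℕ)
    (Q₁ : Matrix (Fin m) (Fin s) ℝ) (Q₂ : Matrix (Fin m) (Fin (m - s)) ℝ) : Prop :=
  s = D.rank ∧
  (Matrix.fromCols Q₁ Q₂).transpose * Matrix.fromCols Q₁ Q₂ = 1 ∧
  Matrix.fromCols Q₁ Q₂ * (Matrix.fromCols Q₁ Q₂).transpose = 1 ∧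
  ∃ (σ : Fin s ⊕ Fin (Fintype.card ι - s) ≃ ι) (R₁₁ : Matrix (Fin s) (Fin s) ℝ)
    (R₁₂ : Matrix (Fin s) (Fin (Fintype.card ι - s)) ℝ),
    R₁₁.BlockTriangular id ∧ IsUnit R₁₁.det ∧
    D.submatrix id σ = Matrix.fromCols Q₁ Q₂ * Matrix.fromBlocks R₁₁ R₁₂ 0 0

end SCD

end

namespace SCD

/-! Let `P` be the metric projection onto the feasible set. The map `z ↦ (P z, z - P z)`
parametrizes the graph of the normal cone mapping, with inverse `(y, v) ↦ y + v`. Since `P` is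
nonexpansive and is a gradient (`IsProjOn.hasFDerivAt`), at every graphically smooth point `P` is
differentiable with a symmetric derivative (`IsProjOn.exists_hasFDerivAt`,
`IsProjOn.inner_deriv_symm`). Symmetry says that the tangent space is isotropic for the standard
symplectic form. Isotropy survives limits, and an isotropic subspace of dimension `m` equals its
adjoint; hence `SC` and `SCstar` agree. For `L` itself, isotropy is the symmetry of `A`.

To see that `L` belongs to the SC derivative, keep `ybar` fixed and add `ε > 0` to every active
multiplier. This gives strict complementarity, and there the tangent cone is exactly the subspace
built like `L` from the perturbed Hessian sum; these subspaces tend to `L` as `ε → 0`. One inclusion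
is `tangent_subset`: strict complementarity and convexity force `h ∈ E`, while MFCQ makes nearby
normals orthogonal to the nearby kernels of the active derivatives, and CRCQ lets every element of
`E` be approximated from these kernels; differentiating the orthogonality relation gives `k - A h ∈
Eᗮ`. The other inclusion is a dimension count: difference quotients of `P` give a tangent `(h, w -
h)` for every `w`, so `(h, k) ↦ h + k` maps the `m`-dimensional space bijectively and leaves no
vector that is not tangent.

The bases come from `E = ker Dᵀ = ker Q₁ᵀ = rge Q₂` and `Eᗮ = rge Q₁`; the factorization itself is
Gram-Schmidt applied to a maximal independent set of columns. -/

/-! ### Adjoint and isotropic subspaces, and their limits. -/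

theorem inner_pair {n m : ℕ} (p q : Pair n m) :
    inner ℝ p q = inner ℝ p.fst q.fst + inner ℝ p.snd q.snd :=
  WithLp.prod_inner_apply p q

theorem finrank_pair (n m : ℕ) : Module.finrank ℝ (Pair n m) = n + m := by
  rw [(WithLp.linearEquiv 2 ℝ (Vec n × Vec m)).finrank_eq, Module.finrank_prod]
  simp

theorem swapNeg_injective (n m : ℕ) : Function.Injective (swapNeg n m) := by
  intro p q h
  have h1 : -p.snd = -q.snd := congrArg WithLp.fst h
  have h2 : p.fst = q.fst := congrArg WithLp.snd h
  exact WithLp.ofLp_injective 2 (Prod.ext h2 (neg_injective h1))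

theorem finrank_adjoint {n m : ℕ} (L : Submodule ℝ (Pair n m)) :
    Module.finrank ℝ L + Module.finrank ℝ (adjoint L) = n + m := by
  rw [adjoint, ((Submodule.equivMapOfInjective _ (swapNeg_injective n m) Lᗮ).finrank_eq).symm,
    Submodule.finrank_add_finrank_orthogonal, finrank_pair]

/-- A subspace of `ℝᵐ × ℝᵐ` is isotropic if the standard symplectic form vanishes on it. -/
def IsIsotropic {m : ℕ} (L : Submodule ℝ (Pair m m)) : Prop :=
  ∀ p ∈ L, ∀ q ∈ L, (inner ℝ p.fst q.snd : ℝ) = inner ℝ p.snd q.fst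

/-- Isotropy gives inclusion in the adjoint, whose dimension is `2m - m = m`. -/
theorem IsIsotropic.eq_adjoint {m : ℕ} {L : Submodule ℝ (Pair m m)} (h : IsIsotropic L)
    (hL : L ∈ Z m m) : L = adjoint L := by
  have hL' : Module.finrank ℝ L = m := hL
  refine Submodule.eq_of_le_of_finrank_eq (fun q hq => ?_) ?_
  -- The preimage of `q` under `swapNeg`.
  · refine ⟨pair q.snd (-q.fst), ?_, ?_⟩
    · rw [SetLike.mem_coe, Submodule.mem_orthogonal]
      intro p hp
      rw [inner_pair]
      change (inner ℝ p.fst q.snd : ℝ) + inner ℝ p.snd (-q.fst) = 0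
      rw [inner_neg_right, h p hp q hq, add_neg_cancel]
    · exact WithLp.ofLp_injective 2 (Prod.ext (neg_neg q.fst) rfl)
  · have := finrank_adjoint L
    omega

theorem tendsto_starProjection_of_subspaceDist {n m : ℕ} {L : Submodule ℝ (Pair n m)}
    {T : ℕ → Submodule ℝ (Pair n m)}
    (h : Tendsto (fun k => subspaceDist L (T k)) atTop (𝓝 0)) {p : Pair n m} (hp : p ∈ L) :
    Tendsto (fun k => (T k).starProjection p) atTop (𝓝 p) := by
  rw [tendsto_iff_norm_sub_tendsto_zero]
  have h' := h.mul_const ‖p‖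
  rw [zero_mul] at h'
  refine squeeze_zero (fun _ => norm_nonneg _) (fun k => ?_) h'
  rw [norm_sub_rev]
  nth_rewrite 1 [← Submodule.starProjection_eq_self_iff.2 hp]
  exact (L.starProjection - (T k).starProjection).le_opNorm p

/-- Elements of the limit are limits of their projections onto the `T k`, and the symplectic form is
continuous. -/
theorem IsIsotropic.of_tendsto {m : ℕ} {L : Submodule ℝ (Pair m m)}
    {T : ℕ → Submodule ℝ (Pair m m)} (hT : ∀ k, IsIsotropic (T k))
    (h : Tendsto (fun k => subspaceDist L (T k)) atTop (𝓝 0)) : IsIsotropic L := by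
  intro p hp q hq
  have hp' := tendsto_starProjection_of_subspaceDist h hp
  have hq' := tendsto_starProjection_of_subspaceDist h hq
  have fstc : Continuous (WithLp.fst : Pair m m → Vec m) := by fun_prop
  have sndc : Continuous (WithLp.snd : Pair m m → Vec m) := by fun_prop
  have h1 := ((fstc.tendsto p).comp hp').inner (𝕜 := ℝ) ((sndc.tendsto q).comp hq')
  have h2 := ((sndc.tendsto p).comp hp').inner (𝕜 := ℝ) ((fstc.tendsto q).comp hq')
  refine tendsto_nhds_unique (h1.congr fun k => ?_) h2
  exact hT k _ (Submodule.starProjection_apply_mem _ _) _ (Submodule.starProjection_apply_mem _ _)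

/-! ### Orthogonal projections onto nearby subspaces. -/

section Projection
variable {F : Type*} [NormedAddCommGroup F] [InnerProductSpace ℝ F]

theorem norm_sub_starProjection_le (V : Submodule ℝ F) [V.HasOrthogonalProjection] {x v : F}
    (hv : v ∈ V) : ‖x - V.starProjection x‖ ≤ ‖x - v‖ := by
  rw [Submodule.starProjection_minimal]
  exact ciInf_le ⟨0, by rintro _ ⟨w, rfl⟩; exact norm_nonneg _⟩ (⟨v, hv⟩ : V)

/-- If all points of `U` are close to `V` and conversely, then the orthogonal projections onto
`U` and `V` are close. -/
theorem norm_starProjection_sub_le (U V : Submodule ℝ F) [U.HasOrthogonalProjection]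
    [V.HasOrthogonalProjection] {δ : ℝ} (hδ : 0 ≤ δ)
    (hUV : ∀ u ∈ U, ∃ v ∈ V, ‖u - v‖ ≤ δ * ‖u‖) (hVU : ∀ v ∈ V, ∃ u ∈ U, ‖v - u‖ ≤ δ * ‖v‖) :
    ‖U.starProjection - V.starProjection‖ ≤ 2 * δ := by
  have key : ∀ (W : Submodule ℝ F) [W.HasOrthogonalProjection] (x : F),
      ‖W.starProjection x‖ ≤ ‖x‖ := fun W _ x => W.norm_starProjection_apply_le x
  refine ContinuousLinearMap.opNorm_le_bound _ (by positivity) fun x => ?_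
  -- The splitting `P_U - P_V = P_U (1 - P_V) - (1 - P_U) P_V`; each term is bounded by `δ`.
  set a := U.starProjection (x - V.starProjection x) with ha
  set b := V.starProjection x - U.starProjection (V.starProjection x) with hb
  have hsub : (U.starProjection - V.starProjection) x = a - b := by
    simp only [ha, hb, map_sub, sub_apply]
    abel
  have hbn : ‖b‖ ≤ δ * ‖x‖ := by
    obtain ⟨u, hu, hle⟩ := hVU _ (V.starProjection_apply_mem x)
    exact (norm_sub_starProjection_le U hu).trans
      (hle.trans (mul_le_mul_of_nonneg_left (key V x) hδ))
  have hy : ‖x - V.starProjection x‖ ≤ ‖x‖ := by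
    simpa using norm_sub_starProjection_le V (x := x) V.zero_mem
  -- The vector `x - P_V x` is orthogonal to `V`, so in `⟪a, x - P_V x⟫` the vector `a ∈ U` may be
  -- replaced by its small distance vector `a - v` to `V`.
  have hsq : ‖a‖ * ‖a‖ ≤ (δ * ‖a‖) * ‖x‖ := by
    obtain ⟨v, hv, hle⟩ := hUV _ (U.starProjection_apply_mem (x - V.starProjection x))
    have h1 : (inner ℝ a a : ℝ) = inner ℝ a (x - V.starProjection x) := by
      have := U.starProjection_inner_eq_zero (x - V.starProjection x) a
        (U.starProjection_apply_mem _)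
      rw [inner_sub_left, ← ha, sub_eq_zero, real_inner_comm] at this
      exact this.symm
    have h2 : (inner ℝ v (x - V.starProjection x) : ℝ) = 0 := by
      rw [real_inner_comm]; exact V.starProjection_inner_eq_zero x v hv
    rw [← real_inner_self_eq_norm_mul_norm, h1]
    calc (inner ℝ a (x - V.starProjection x) : ℝ)
        = inner ℝ (a - v) (x - V.starProjection x) := by rw [inner_sub_left, h2, sub_zero]
      _ ≤ ‖a - v‖ * ‖x - V.starProjection x‖ := real_inner_le_norm _ _
      _ ≤ (δ * ‖a‖) * ‖x‖ := mul_le_mul hle hy (norm_nonneg _) (by positivity)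
  have han : ‖a‖ ≤ δ * ‖x‖ := by
    rcases (norm_nonneg a).eq_or_lt with h0 | h0
    · rw [← h0]; positivity
    · exact le_of_mul_le_mul_right (by linarith) h0
  rw [hsub]
  linarith [norm_sub_le a b]

end Projection

/-! ### The subspaces `{(h, k) | h ∈ E, k - A h ∈ Eᗮ}` -/

theorem mem_comap_shear {m : ℕ} {A : Matrix (Fin m) (Fin m) ℝ} {U W : Submodule ℝ (Vec m)}
    {p : Pair m m} : p ∈ (prodSubspace U W).comap (shear A) ↔
      p.fst ∈ U ∧ p.snd - Matrix.toEuclideanLin A p.fst ∈ W := Iff.rfl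

theorem finrank_prodSubspace {n m : ℕ} (U : Submodule ℝ (Vec n)) (W : Submodule ℝ (Vec m)) :
    Module.finrank ℝ (prodSubspace U W) = Module.finrank ℝ U + Module.finrank ℝ W := by
  have e : prodSubspace U W =
      (U.prod W).map (WithLp.linearEquiv 2 ℝ (Vec n × Vec m)).symm.toLinearMap :=
    Submodule.comap_equiv_eq_map_symm _ _
  have hr : U.prod W = LinearMap.range (U.subtype.prodMap W.subtype) := by
    rw [LinearMap.range_prodMap, Submodule.range_subtype, Submodule.range_subtype]
  rw [e, LinearEquiv.finrank_map_eq, hr, LinearMap.finrank_range_of_inj, Module.finrank_prod]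
  exact Subtype.val_injective.prodMap Subtype.val_injective

theorem prodSubspace_orthogonal_mem_Z {m : ℕ} (E : Submodule ℝ (Vec m)) :
    prodSubspace E Eᗮ ∈ Z m m := by
  change Module.finrank ℝ _ = m
  rw [finrank_prodSubspace, Submodule.finrank_add_finrank_orthogonal]
  simp

/-- The shear map `(h, k) ↦ (h, k - A h)` is invertible. -/
noncomputable def shearEquiv {m : ℕ} (A : Matrix (Fin m) (Fin m) ℝ) : Pair m m ≃ₗ[ℝ] Pair m m :=
  LinearEquiv.ofBijective (shear A) <| by
    refine (LinearMap.injective_iff_surjective).1 (LinearMap.ker_eq_bot.1 ?_) |> fun hs =>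
      ⟨LinearMap.injective_iff_surjective.2 hs, hs⟩
    rw [LinearMap.ker_eq_bot']
    intro p hp
    have h1 : p.fst = 0 := congrArg WithLp.fst hp
    have h2 : p.snd - Matrix.toEuclideanLin A p.fst = 0 := congrArg WithLp.snd hp
    rw [h1, map_zero, sub_zero] at h2
    exact WithLp.ofLp_injective 2 (Prod.ext h1 h2)

theorem finrank_comap_shear {m : ℕ} (A : Matrix (Fin m) (Fin m) ℝ) (M : Submodule ℝ (Pair m m)) :
    Module.finrank ℝ (M.comap (shear A)) = Module.finrank ℝ M := by
  have e : M.comap (shear A) = M.map (shearEquiv A).symm.toLinearMap :=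
    Submodule.comap_equiv_eq_map_symm (shearEquiv A) M
  rw [e, LinearEquiv.finrank_map_eq]

theorem comap_shear_mem_Z {m : ℕ} (A : Matrix (Fin m) (Fin m) ℝ) (E : Submodule ℝ (Vec m)) :
    (prodSubspace E Eᗮ).comap (shear A) ∈ Z m m := by
  change Module.finrank ℝ _ = m
  rw [finrank_comap_shear]
  exact prodSubspace_orthogonal_mem_Z E

theorem isIsotropic_comap_shear {m : ℕ} {A : Matrix (Fin m) (Fin m) ℝ}
    (hA : (Matrix.toEuclideanLin A).IsSymmetric) (E : Submodule ℝ (Vec m)) :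
    IsIsotropic ((prodSubspace E Eᗮ).comap (shear A)) := by
  intro p hp q hq
  obtain ⟨hp1, hp2⟩ := mem_comap_shear.1 hp
  obtain ⟨hq1, hq2⟩ := mem_comap_shear.1 hq
  have h1 := Submodule.inner_right_of_mem_orthogonal hp1 hq2
  have h2 := Submodule.inner_left_of_mem_orthogonal hq1 hp2
  rw [inner_sub_right] at h1
  rw [inner_sub_left] at h2
  have := hA p.fst q.fst
  linarith

theorem subspaceDist_comap_shear_le {m : ℕ} (A B : Matrix (Fin m) (Fin m) ℝ)
    (U W : Submodule ℝ (Vec m)) {C : ℝ} (hC : 0 ≤ C)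
    (h : ∀ x, ‖Matrix.toEuclideanLin A x - Matrix.toEuclideanLin B x‖ ≤ C * ‖x‖) :
    subspaceDist ((prodSubspace U W).comap (shear A)) ((prodSubspace U W).comap (shear B)) ≤
      2 * C := by
  have key : ∀ A B : Matrix (Fin m) (Fin m) ℝ,
      (∀ x, ‖Matrix.toEuclideanLin A x - Matrix.toEuclideanLin B x‖ ≤ C * ‖x‖) →
      ∀ p ∈ (prodSubspace U W).comap (shear A), ∃ q ∈ (prodSubspace U W).comap (shear B),
        ‖p - q‖ ≤ C * ‖p‖ := by
    intro A B h p hp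
    obtain ⟨hp1, hp2⟩ := mem_comap_shear.1 hp
    -- Correcting the second component by `(A - B) h` leaves the sheared vector unchanged.
    refine ⟨pair p.fst (p.snd - (Matrix.toEuclideanLin A p.fst - Matrix.toEuclideanLin B p.fst)),
      mem_comap_shear.2 ⟨hp1, ?_⟩, ?_⟩
    · change p.snd - (_ - Matrix.toEuclideanLin B p.fst) - Matrix.toEuclideanLin B p.fst ∈ W
      convert hp2 using 1
      abel
    · have : p - pair p.fst
          (p.snd - (Matrix.toEuclideanLin A p.fst - Matrix.toEuclideanLin B p.fst)) =
          pair 0 (Matrix.toEuclideanLin A p.fst - Matrix.toEuclideanLin B p.fst) :=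
        WithLp.ofLp_injective 2 (Prod.ext (sub_self p.fst) (sub_sub_cancel _ _))
      rw [this]
      have hle : ‖p.fst‖ ≤ ‖p‖ := WithLp.norm_fst_le _ p
      calc _ = ‖Matrix.toEuclideanLin A p.fst - Matrix.toEuclideanLin B p.fst‖ :=
            WithLp.norm_toLp_snd 2 _ _ _
        _ ≤ C * ‖p.fst‖ := h _
        _ ≤ C * ‖p‖ := mul_le_mul_of_nonneg_left hle hC
  exact norm_starProjection_sub_le _ _ hC (key A B h)
    (key B A fun x => by rw [norm_sub_rev]; exact h x)

/-! ### The normal cone mapping of a closed convex set is graphically a symmetric Lipschitz map -/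

/-- For a convex set, segments make every `x - y` a tangent direction; conversely tangents are
limits of nonnegative multiples of such differences. -/
theorem mem_regularNormalCone_iff {m : ℕ} {A : Set (Vec m)} (hA : Convex ℝ A) {y v : Vec m} :
    v ∈ regularNormalCone A y ↔ y ∈ A ∧ ∀ x ∈ A, (inner ℝ v (x - y) : ℝ) ≤ 0 := by
  refine and_congr_right fun hy => ⟨fun h x hx => ?_, fun h w hw => ?_⟩
  · exact h _ (sub_mem_posTangentConeAt_of_segment_subset (hA.segment_subset hy hx))
  · obtain ⟨α, l, hl, c, d, hd, hmem, hcd⟩ := exists_fun_of_mem_tangentConeAt hw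
    refine le_of_tendsto (tendsto_const_nhds.inner hcd) (hmem.mono fun a ha => ?_)
    have := h _ ha
    rw [add_sub_cancel_left] at this
    change (inner ℝ v ((c a : ℝ) • d a) : ℝ) ≤ 0
    rw [real_inner_smul_right]
    exact mul_nonpos_of_nonneg_of_nonpos (c a).2 this

/-! ### The metric projection onto a convex set. -/

section Proj
variable {F : Type*} [NormedAddCommGroup F] [InnerProductSpace ℝ F]

/-- `P` is the metric projection onto the convex set `A`. -/
def IsProjOn (A : Set F) (P : F → F) : Prop :=
  ∀ z, P z ∈ A ∧ ∀ x ∈ A, (inner ℝ (z - P z) (x - P z) : ℝ) ≤ 0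

theorem exists_isProjOn {A : Set F} (hne : A.Nonempty) (hA : IsComplete A) (hc : Convex ℝ A) :
    ∃ P : F → F, IsProjOn A P := by
  have : ∀ z, ∃ y ∈ A, ∀ x ∈ A, (inner ℝ (z - y) (x - y) : ℝ) ≤ 0 := fun z => by
    obtain ⟨y, hy, h⟩ := exists_norm_eq_iInf_of_complete_convex hne hA hc z
    exact ⟨y, hy, (norm_eq_iInf_iff_real_inner_le_zero hc hy).1 h⟩
  choose P h1 h2 using this
  exact ⟨P, fun z => ⟨h1 z, h2 z⟩⟩

variable {A : Set F} {P : F → F}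

theorem IsProjOn.eq_of_normal (hP : IsProjOn A P) {y v : F} (hy : y ∈ A)
    (hv : ∀ x ∈ A, (inner ℝ v (x - y) : ℝ) ≤ 0) : P (y + v) = y := by
  have h1 := hv _ (hP (y + v)).1
  have h2 := (hP (y + v)).2 y hy
  rw [← sub_eq_zero, ← real_inner_self_nonpos]
  have e : y + v - P (y + v) = v - (P (y + v) - y) := by abel
  rw [e, ← neg_sub (P (y + v)) y, inner_neg_right, inner_sub_left] at h2
  linarith

theorem IsProjOn.norm_sub_le (hP : IsProjOn A P) (z w : F) : ‖P z - P w‖ ≤ ‖z - w‖ := by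
  have h1 := (hP z).2 _ (hP w).1
  have h2 := (hP w).2 _ (hP z).1
  have h3 : ‖P z - P w‖ * ‖P z - P w‖ ≤ ‖z - w‖ * ‖P z - P w‖ := by
    refine le_trans ?_ (real_inner_le_norm (z - w) (P z - P w))
    rw [← real_inner_self_eq_norm_mul_norm]
    have e : (inner ℝ (z - w) (P z - P w) : ℝ) - inner ℝ (P z - P w) (P z - P w) =
        -inner ℝ (z - P z) (P w - P z) - inner ℝ (w - P w) (P z - P w) := by
      simp only [inner_sub_left, inner_sub_right]
      ring
    linarith
  rcases (norm_nonneg (P z - P w)).eq_or_lt with h0 | h0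
  · rw [← h0]; exact norm_nonneg _
  · exact le_of_mul_le_mul_right h3 h0

/-- The metric projection is the gradient of the Moreau envelope. -/
theorem IsProjOn.hasFDerivAt (hP : IsProjOn A P) (z : F) :
    HasFDerivAt (fun z => (inner ℝ z (P z) : ℝ) - inner ℝ (P z) (P z) / 2)
      (innerSL ℝ (P z)) z := by
  rw [hasFDerivAt_iff_isLittleO, Asymptotics.isLittleO_iff]
  intro c hc
  filter_upwards [Metric.ball_mem_nhds z hc] with w hw
  have hw' : ‖w - z‖ < c := by rwa [Metric.mem_ball, dist_eq_norm] at hw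
  have h1 := (hP z).2 _ (hP w).1
  have h2 := (hP w).2 _ (hP z).1
  -- Completing the square: the variational inequality makes `P b` a maximizer of `x ↦ ⟪b, x⟫ - ‖x‖²
  -- / 2` over `A`. Comparing the maximizers at `z` and `w` squeezes the remainder between `0` and
  -- `⟪P w - P z, w - z⟫ ≤ ‖w - z‖²`.
  have key : ∀ b x y : F, (inner ℝ (b - y) (x - y) : ℝ) ≤ 0 →
      (inner ℝ b x : ℝ) - inner ℝ x x / 2 ≤ inner ℝ b y - inner ℝ y y / 2 := by
    intro b x y h
    have h0 : (0 : ℝ) ≤ inner ℝ (x - y) (x - y) := real_inner_self_nonneg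
    simp only [inner_sub_left, inner_sub_right] at h h0
    rw [real_inner_comm x y] at *
    linarith
  have k1 := key w (P z) (P w) h2
  have k2 := key z (P w) (P z) h1
  have lower : 0 ≤ (inner ℝ w (P w) : ℝ) - inner ℝ (P w) (P w) / 2 -
      (inner ℝ z (P z) - inner ℝ (P z) (P z) / 2) - inner ℝ (P z) (w - z) := by
    rw [inner_sub_right, real_inner_comm w (P z), real_inner_comm z (P z)]
    linarith
  have upper : (inner ℝ w (P w) : ℝ) - inner ℝ (P w) (P w) / 2 -
      (inner ℝ z (P z) - inner ℝ (P z) (P z) / 2) - inner ℝ (P z) (w - z) ≤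
      inner ℝ (P w - P z) (w - z) := by
    rw [inner_sub_right, inner_sub_left, inner_sub_right, inner_sub_right,
      real_inner_comm w (P z), real_inner_comm z (P z), real_inner_comm w (P w),
      real_inner_comm z (P w)]
    linarith
  rw [innerSL_apply_apply, Real.norm_eq_abs, abs_of_nonneg lower]
  calc _ ≤ (inner ℝ (P w - P z) (w - z) : ℝ) := upper
    _ ≤ ‖P w - P z‖ * ‖w - z‖ := real_inner_le_norm _ _
    _ ≤ c * ‖w - z‖ :=
      mul_le_mul_of_nonneg_right ((hP.norm_sub_le w z).trans hw'.le) (norm_nonneg _)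

/-- A derivative of `P` is a second derivative of the Moreau-type potential, hence symmetric. -/
theorem IsProjOn.inner_deriv_symm (hP : IsProjOn A P) {z : F} {B : F →L[ℝ] F}
    (hB : HasFDerivAt P B z) (u w : F) : (inner ℝ (B u) w : ℝ) = inner ℝ (B w) u := by
  have h2 : HasFDerivAt (fun z => innerSL ℝ (P z)) ((innerSL ℝ).comp B) z :=
    (innerSL ℝ).hasFDerivAt.comp z hB
  exact second_derivative_symmetric (fun z => hP.hasFDerivAt z) h2 u w

end Proj

theorem norm_nnreal_smul {F : Type*} [NormedAddCommGroup F] [NormedSpace ℝ F] (t : NNReal) (x : F) :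
    ‖t • x‖ = t * ‖x‖ := by
  rw [NNReal.smul_def, norm_smul, NNReal.norm_eq]

theorem tendsto_pair {m : ℕ} {α : Type*} {l : Filter α} {f g : α → Vec m} {a b : Vec m}
    (hf : Tendsto f l (𝓝 a)) (hg : Tendsto g l (𝓝 b)) :
    Tendsto (fun x => pair (f x) (g x)) l (𝓝 (pair a b)) :=
  ((WithLp.prod_continuous_toLp 2 (Vec m) (Vec m)).tendsto (a, b)).comp (hf.prodMk_nhds hg)

/-! ### Tangents to the graph through the projection. -/

section NormalCone

variable {m : ℕ} {A : Set (Vec m)} {P : Vec m → Vec m}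

theorem IsProjOn.pair_mem_gph (hA : Convex ℝ A) (hP : IsProjOn A P) (z : Vec m) :
    pair (P z) (z - P z) ∈ gph (regularNormalCone A) :=
  (mem_regularNormalCone_iff hA).2 (hP z)

/-- Difference quotients of the projection accumulate at tangent directions of the graph of the
normal cone mapping. -/
theorem IsProjOn.exists_tangent (hA : Convex ℝ A) (hP : IsProjOn A P) {p : Pair m m}
    (hp : p ∈ gph (regularNormalCone A)) {α : Type*} (l : Ultrafilter α) {t : α → NNReal}
    {w : α → Vec m} {w₀ : Vec m} (htw : Tendsto (fun a => t a • w a) l (𝓝 0))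
    (ht : ∀ᶠ a in l, t a ≠ 0) (hw : Tendsto w l (𝓝 w₀)) :
    ∃ h : Vec m, Tendsto (fun a => (t a)⁻¹ • (P (p.fst + p.snd + t a • w a) - p.fst)) l (𝓝 h) ∧
      pair h (w₀ - h) ∈ posTangentConeAt (gph (regularNormalCone A)) p := by
  set z := p.fst + p.snd with hz
  obtain ⟨hy, hv⟩ := (mem_regularNormalCone_iff hA).1 hp
  have hPz : P z = p.fst := hP.eq_of_normal hy hv
  set D := fun a => P (z + t a • w a) - p.fst with hD
  have hDle : ∀ a, ‖D a‖ ≤ ‖t a • w a‖ := fun a => by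
    have := hP.norm_sub_le (z + t a • w a) z
    rwa [hPz, add_sub_cancel_left] at this
  -- Nonexpansiveness bounds the quotients, so compactness makes them converge along the
  -- ultrafilter.
  have hbd : ∀ᶠ a in (l : Filter α), (t a)⁻¹ • D a ∈ Metric.closedBall (0 : Vec m) (‖w₀‖ + 1) := by
    filter_upwards [ht, hw.norm.eventually (gt_mem_nhds (lt_add_one ‖w₀‖))] with a ha haw
    have h0 : (0 : ℝ) < t a := NNReal.coe_pos.2 (pos_iff_ne_zero.2 ha)
    have := hDle a
    rw [norm_nnreal_smul] at this
    rw [mem_closedBall_zero_iff, norm_nnreal_smul, NNReal.coe_inv, inv_mul_le_iff₀ h0]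
    exact this.trans (mul_le_mul_of_nonneg_left haw.le h0.le)
  obtain ⟨h, -, hh⟩ := (isCompact_closedBall (0 : Vec m) (‖w₀‖ + 1)).ultrafilter_le_nhds
    (l.map fun a => (t a)⁻¹ • D a) (tendsto_principal.2 hbd)
  have hh' : Tendsto (fun a => (t a)⁻¹ • D a) l (𝓝 h) := hh
  refine ⟨h, hh', ?_⟩
  have hD0 : Tendsto D l (𝓝 0) :=
    squeeze_zero_norm hDle (by simpa using htw.norm)
  refine mem_tangentConeAt_of_seq (l : Filter α) (fun a => (t a)⁻¹)
    (fun a => pair (D a) (t a • w a - D a)) ?_ (Eventually.of_forall fun a => ?_) ?_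
  · have := tendsto_pair hD0 (htw.sub hD0)
    rw [sub_zero] at this
    exact this
  · have e : p + pair (D a) (t a • w a - D a) =
        pair (P (z + t a • w a)) (z + t a • w a - P (z + t a • w a)) := by
      refine WithLp.ofLp_injective 2 (Prod.ext ?_ ?_)
      · change p.fst + (P (z + t a • w a) - p.fst) = P (z + t a • w a)
        abel
      · have : z - p.fst = p.snd := by rw [hz, add_sub_cancel_left]
        change p.snd + (t a • w a - (P (z + t a • w a) - p.fst)) = z + t a • w a - P (z + t a • w a)
        rw [← this]
        abel
    rw [e]
    exact hP.pair_mem_gph hA _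
  · have : Tendsto (fun a => pair ((t a)⁻¹ • D a) (w a - (t a)⁻¹ • D a)) l
      (𝓝 (pair h (w₀ - h))) := tendsto_pair hh' (hw.sub hh')
    refine this.congr' (ht.mono fun a ha => ?_)
    refine WithLp.ofLp_injective 2 (Prod.ext rfl ?_)
    change w a - (t a)⁻¹ • D a = (t a)⁻¹ • (t a • w a - D a)
    rw [smul_sub _ (t a • w a), smul_smul, inv_mul_cancel₀ ha, one_smul]

/-- The infinitesimal form of nonexpansiveness, using `P (y + v) = y` on the graph. It makes
`sumMap` injective on tangent spaces. -/
theorem IsProjOn.norm_le_of_tangent (hA : Convex ℝ A) (hP : IsProjOn A P) {p q : Pair m m}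
    (hp : p ∈ gph (regularNormalCone A))
    (hq : q ∈ posTangentConeAt (gph (regularNormalCone A)) p) : ‖q.fst‖ ≤ ‖q.fst + q.snd‖ := by
  obtain ⟨α, l, hl, c, d, hd, hmem, hcd⟩ := exists_fun_of_mem_tangentConeAt hq
  have fstc : Continuous (WithLp.fst : Pair m m → Vec m) := by fun_prop
  have sndc : Continuous (WithLp.snd : Pair m m → Vec m) := by fun_prop
  have h1 := (fstc.tendsto q).comp hcd
  have h2 := (sndc.tendsto q).comp hcd
  refine le_of_tendsto_of_tendsto h1.norm (h1.add h2).norm (hmem.mono fun a ha => ?_)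
  have e : ∀ p ∈ gph (regularNormalCone A), P (p.fst + p.snd) = p.fst := fun p hp => by
    obtain ⟨hy, hv⟩ := (mem_regularNormalCone_iff hA).1 hp
    exact hP.eq_of_normal hy hv
  have := hP.norm_sub_le ((p + d a).fst + (p + d a).snd) (p.fst + p.snd)
  rw [e _ ha, e _ hp] at this
  simp only [WithLp.add_fst, WithLp.add_snd, add_sub_cancel_left] at this
  have e2 : p.fst + (d a).fst + (p.snd + (d a).snd) - (p.fst + p.snd) =
    (d a).fst + (d a).snd := by abel
  rw [e2] at this
  change ‖(c a : ℝ) • (d a).fst‖ ≤ ‖(c a : ℝ) • (d a).fst + (c a : ℝ) • (d a).snd‖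
  rw [← smul_add, norm_smul, norm_smul]
  exact mul_le_mul_of_nonneg_left this (norm_nonneg _)

/-- The linear map `(h, k) ↦ h + k`. -/
def sumMap (m : ℕ) : Pair m m →ₗ[ℝ] Vec m where
  toFun p := p.fst + p.snd
  map_add' p q := by
    simp only [WithLp.add_fst, WithLp.add_snd]
    abel
  map_smul' c p := by
    simp only [WithLp.smul_fst, WithLp.smul_snd, smul_add, RingHom.id_apply]

/-- The tangent space at a graphically smooth point is the graph, in the coordinates `(h, h + k)`,
of the derivative of the projection. -/
theorem IsProjOn.exists_hasFDerivAt (hA : Convex ℝ A) (hP : IsProjOn A P) {p : Pair m m}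
    {T : Submodule ℝ (Pair m m)} (hT : IsSmoothPoint (regularNormalCone A) p T) :
    ∃ B : Vec m →L[ℝ] Vec m, HasFDerivAt P B (p.fst + p.snd) ∧
      ∀ q ∈ T, B (q.fst + q.snd) = q.fst := by
  obtain ⟨hp, hTZ, hcone⟩ := hT
  have hTZ' : Module.finrank ℝ T = m := hTZ
  have hmem : ∀ q, q ∈ posTangentConeAt (gph (regularNormalCone A)) p ↔ q ∈ T := fun q => by
    rw [hcone]; rfl
  have hinj : Function.Injective ((sumMap m).domRestrict T) := by
    rw [← LinearMap.ker_eq_bot, LinearMap.ker_eq_bot']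
    intro q hq
    have h0 : (q : Pair m m).fst + (q : Pair m m).snd = 0 := hq
    have h1 := hP.norm_le_of_tangent hA hp ((hmem q).2 q.2)
    rw [h0, norm_zero, norm_le_zero_iff] at h1
    rw [h1, zero_add] at h0
    exact Subtype.ext (WithLp.ofLp_injective 2 (Prod.ext h1 h0))
  let S := LinearEquiv.ofInjectiveOfFinrankEq ((sumMap m).domRestrict T) hinj
    (by rw [hTZ']; simp)
  let fstL : Pair m m →ₗ[ℝ] Vec m := WithLp.fstₗ 2 ℝ _ _
  let B₀ : Vec m →ₗ[ℝ] Vec m := fstL ∘ₗ T.subtype ∘ₗ S.symm.toLinearMap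
  have hB₀ : ∀ q ∈ T, B₀ (q.fst + q.snd) = q.fst := fun q hq => by
    have : S ⟨q, hq⟩ = q.fst + q.snd := rfl
    change fstL (T.subtype (S.symm (q.fst + q.snd))) = q.fst
    rw [← this, LinearEquiv.symm_apply_apply]
    rfl
  refine ⟨LinearMap.toContinuousLinearMap B₀, ?_, hB₀⟩
  obtain ⟨hy, hv⟩ := (mem_regularNormalCone_iff hA).1 hp
  have hPz : P (p.fst + p.snd) = p.fst := hP.eq_of_normal hy hv
  rw [hasFDerivAt_iff_isLittleO_nhds_zero, Asymptotics.isLittleO_iff]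
  -- If differentiability fails, an ultrafilter tends to `0` through increments with error above `c
  -- * ‖x‖`. Along it the unit directions converge, and `exists_tangent` identifies the limit of the
  -- quotients as the value of `B₀`, a contradiction.
  by_contra hcon
  push Not at hcon
  obtain ⟨c, hc, hfr⟩ := hcon
  have hne := frequently_iff_neBot.1 hfr
  let l := Ultrafilter.of (𝓝 (0 : Vec m) ⊓ 𝓟 {x | c * ‖x‖ <
    ‖P (p.fst + p.snd + x) - P (p.fst + p.snd) - (LinearMap.toContinuousLinearMap B₀) x‖})
  have hl := Ultrafilter.of_le (𝓝 (0 : Vec m) ⊓ 𝓟 {x | c * ‖x‖ <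
    ‖P (p.fst + p.snd + x) - P (p.fst + p.snd) - (LinearMap.toContinuousLinearMap B₀) x‖})
  have hl0 : Tendsto id (l : Filter (Vec m)) (𝓝 0) := hl.trans inf_le_left
  have hbad : ∀ᶠ x in (l : Filter (Vec m)), c * ‖x‖ <
      ‖P (p.fst + p.snd + x) - P (p.fst + p.snd) - B₀ x‖ :=
    hl.trans inf_le_right (mem_principal_self _)
  have hx0 : ∀ᶠ x in (l : Filter (Vec m)), x ≠ 0 := hbad.mono fun x hx h0 => by
    subst h0
    simp at hx
  have hsph : ∀ᶠ x in (l : Filter (Vec m)), ‖x‖₊⁻¹ • x ∈ Metric.closedBall (0 : Vec m) 1 :=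
    hx0.mono fun x hx => by
      rw [mem_closedBall_zero_iff]
      rw [norm_nnreal_smul, NNReal.coe_inv, coe_nnnorm, inv_mul_cancel₀ (norm_ne_zero_iff.2 hx)]
  obtain ⟨w₀, -, hw⟩ := (isCompact_closedBall (0 : Vec m) 1).ultrafilter_le_nhds
    (l.map fun x => ‖x‖₊⁻¹ • x) (tendsto_principal.2 hsph)
  have hw' : Tendsto (fun x : Vec m => ‖x‖₊⁻¹ • x) l (𝓝 w₀) := hw
  have hcancel : ∀ x : Vec m, ‖x‖₊ • ‖x‖₊⁻¹ • x = x := fun x => by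
    rcases eq_or_ne x 0 with rfl | hx
    · simp
    · rw [smul_smul, mul_inv_cancel₀ (by simpa using hx), one_smul]
  obtain ⟨h, hh, ht⟩ := hP.exists_tangent hA hp l (t := fun x => ‖x‖₊)
    (w := fun x => ‖x‖₊⁻¹ • x) (hl0.congr fun x => (hcancel x).symm)
    (hx0.mono fun x hx => by simpa using hx) hw'
  simp only [hcancel] at hh
  have hBw : B₀ w₀ = h := by
    have := hB₀ _ ((hmem _).1 ht)
    change B₀ (h + (w₀ - h)) = h at this
    rwa [add_sub_cancel] at this
  have hlim : Tendsto (fun x : Vec m => ‖x‖₊⁻¹ • (P (p.fst + p.snd + x) - p.fst) -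
      B₀ (‖x‖₊⁻¹ • x)) l (𝓝 (h - h)) := by
    refine hh.sub ?_
    have := ((LinearMap.toContinuousLinearMap B₀).continuous.tendsto w₀).comp hw'
    rw [← hBw]
    exact this
  rw [sub_self] at hlim
  have hlim' := hlim.norm
  rw [norm_zero] at hlim'
  obtain ⟨x, hx1, hx2, hx3⟩ :=
    ((hlim'.eventually (gt_mem_nhds hc)).and (hbad.and hx0)).exists
  have hxp : 0 < ‖x‖ := norm_pos_iff.2 hx3
  have e : ‖x‖₊⁻¹ • (P (p.fst + p.snd + x) - p.fst) - B₀ (‖x‖₊⁻¹ • x) =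
      ‖x‖⁻¹ • (P (p.fst + p.snd + x) - p.fst - B₀ x) := by
    rw [smul_sub _ _ (B₀ x)]
    congr 1
    exact B₀.map_smul (‖x‖⁻¹) x
  rw [hPz] at hx2
  rw [e, norm_smul, norm_inv, norm_norm, inv_mul_lt_iff₀ hxp] at hx1
  linarith [mul_comm c ‖x‖]

/-- In the identity `⟪B u, w⟫ = ⟪B w, u⟫` with `u = h + k`, `w = h' + k'`, the terms `⟪h, h'⟫`
cancel and leave the symplectic relation. -/
theorem IsProjOn.isIsotropic_of_isSmoothPoint (hA : Convex ℝ A) (hP : IsProjOn A P) {p : Pair m m}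
    {T : Submodule ℝ (Pair m m)} (hT : IsSmoothPoint (regularNormalCone A) p T) :
    IsIsotropic T := by
  obtain ⟨B, hB, hBT⟩ := hP.exists_hasFDerivAt hA hT
  intro q hq r hr
  have h := hP.inner_deriv_symm hB (q.fst + q.snd) (r.fst + r.snd)
  rw [hBT q hq, hBT r hr, inner_add_right, inner_add_right, real_inner_comm q.fst r.fst,
    real_inner_comm q.snd r.fst] at h
  linarith

theorem adjoint_eq_of_mem_SC (hA : Convex ℝ A) (hcl : IsClosed A)
    {x y : Vec m} {L : Submodule ℝ (Pair m m)}
    (hL : L ∈ SC (regularNormalCone A) x y) : adjoint L = L := by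
  obtain ⟨hLZ, p, T, hT, -, hd⟩ := hL
  obtain ⟨P, hP⟩ := exists_isProjOn ⟨_, (hT 0).1.1⟩ hcl.isComplete hA
  exact ((IsIsotropic.of_tendsto (fun k => hP.isIsotropic_of_isSmoothPoint hA (hT k)) hd).eq_adjoint
    hLZ).symm

theorem SC_eq_SCstar (hA : Convex ℝ A) (hcl : IsClosed A) (x y : Vec m) :
    SC (regularNormalCone A) x y = SCstar (regularNormalCone A) x y := by
  ext L
  constructor
  · exact fun hL => ⟨L, hL, adjoint_eq_of_mem_SC hA hcl hL⟩
  · rintro ⟨K, hK, rfl⟩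
    rwa [adjoint_eq_of_mem_SC hA hcl hK]

end NormalCone

/-! ### Lower semicontinuity of subspaces of constant dimension -/

/-- If the subspaces `G a` have the dimension of `E` and all limits of their elements lie in `E`,
then every element of `E` is such a limit. -/
theorem exists_tendsto_of_finrank_eq {F α : Type*} [NormedAddCommGroup F]
    [InnerProductSpace ℝ F] [FiniteDimensional ℝ F] (l : Ultrafilter α) {G : α → Submodule ℝ F}
    {E : Submodule ℝ F} (hdim : ∀ᶠ a in (l : Filter α), Module.finrank ℝ (G a) =
      Module.finrank ℝ E)
    (hlim : ∀ (b : α → F) (b₀ : F), (∀ᶠ a in (l : Filter α), b a ∈ G a) →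
      Tendsto b l (𝓝 b₀) → b₀ ∈ E) {e : F} (he : e ∈ E) :
    ∃ f : α → F, (∀ᶠ a in (l : Filter α), f a ∈ G a) ∧ Tendsto f l (𝓝 e) := by
  classical
  set r := Module.finrank ℝ E
  have hb : ∀ a, ∃ b : Fin r → F, Module.finrank ℝ (G a) = r → Orthonormal ℝ b ∧
      ∀ i, b i ∈ G a := fun a => by
    by_cases h : Module.finrank ℝ (G a) = r
    · let B := (stdOrthonormalBasis ℝ (G a)).reindex (finCongr h)
      exact ⟨fun i => B i, fun _ => ⟨B.orthonormal.comp_linearIsometry (G a).subtypeₗᵢ,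
        fun i => (B i).2⟩⟩
    · exact ⟨0, fun h' => absurd h' h⟩
  choose b hb using hb
  have hlimb : ∀ i, ∃ c : F, Tendsto (fun a => b a i) l (𝓝 c) := fun i => by
    obtain ⟨c, -, hc⟩ := (isCompact_closedBall (0 : F) 1).ultrafilter_le_nhds
      (l.map fun a => b a i) (tendsto_principal.2 (hdim.mono fun a ha => by
        rw [mem_closedBall_zero_iff, (hb a ha).1.1 i]))
    exact ⟨c, hc⟩
  choose c hc using hlimb
  have hcE : ∀ i, c i ∈ E := fun i => hlim _ _ (hdim.mono fun a ha => (hb a ha).2 i) (hc i)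
  -- Limits of orthonormal families are orthonormal, so `r` of them inside `E` form a basis of `E`.
  have hon : Orthonormal ℝ (fun i => (⟨c i, hcE i⟩ : E)) := by
    rw [orthonormal_iff_ite]
    intro i j
    refine tendsto_nhds_unique ((hc i).inner (𝕜 := ℝ) (hc j))
      (tendsto_const_nhds.congr' (hdim.mono fun a ha => ?_))
    exact ((orthonormal_iff_ite.1 (hb a ha).1) i j).symm
  let C := OrthonormalBasis.mk hon
    (hon.linearIndependent.span_eq_top_of_card_eq_finrank' (by simp [r])).ge
  have hsum : ∑ i, (inner ℝ (c i) e : ℝ) • c i = e := by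
    have h := congrArg (E.subtype) (C.sum_repr' ⟨e, he⟩)
    rw [map_sum] at h
    simpa [C] using h
  -- The orthogonal projection of `e` onto `G a`, written in the chosen basis.
  refine ⟨fun a => ∑ i, (inner ℝ (b a i) e : ℝ) • b a i, hdim.mono fun a ha =>
    Submodule.sum_mem _ fun i _ => Submodule.smul_mem _ _ ((hb a ha).2 i), ?_⟩
  suffices h : Tendsto (fun a => ∑ i, (inner ℝ (b a i) e : ℝ) • b a i) l
      (𝓝 (∑ i, (inner ℝ (c i) e : ℝ) • c i)) by rwa [hsum] at h
  exact tendsto_finsetSum _ fun i _ => ((hc i).inner (𝕜 := ℝ) tendsto_const_nhds).smul (hc i)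

/-! ### Smooth convex inequality systems -/

theorem fderiv_le_sub_of_convexOn {F : Type*} [NormedAddCommGroup F] [NormedSpace ℝ F] {f : F → ℝ}
    (hf : ConvexOn ℝ univ f) {y : F} (hd : DifferentiableAt ℝ f y) (x : F) :
    fderiv ℝ f y (x - y) ≤ f x - f y := by
  have hc : ConvexOn ℝ univ (f ∘ AffineMap.lineMap (k := ℝ) y x) := by
    simpa using hf.comp_affineMap (AffineMap.lineMap (k := ℝ) y x)
  have hd' : HasDerivAt (f ∘ AffineMap.lineMap (k := ℝ) y x) (fderiv ℝ f y (x - y)) 0 := by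
    refine HasFDerivAt.comp_hasDerivAt (0 : ℝ) (f := AffineMap.lineMap (k := ℝ) y x) ?_
      AffineMap.hasDerivAt_lineMap
    rw [AffineMap.lineMap_apply_zero]
    exact hd.hasFDerivAt
  have := hc.le_slope_of_hasDerivAt (mem_univ 0) (mem_univ 1) zero_lt_one hd'
  simpa [slope_def_field] using this

variable {m l : ℕ} {g : Fin l → Vec m → ℝ}

theorem mem_active {y : Vec m} {i : Fin l} : i ∈ active g y ↔ g i y = 0 := by
  simp [active]

theorem convex_feasibleSet (hconv : ∀ i, ConvexOn ℝ univ (g i)) : Convex ℝ (feasibleSet g) := by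
  have : feasibleSet g = ⋂ i, {y ∈ univ | g i y ≤ 0} := by
    ext y
    simp [feasibleSet]
  rw [this]
  exact convex_iInter fun i => (hconv i).convex_le 0

theorem isClosed_feasibleSet (hc : ∀ i, Continuous (g i)) : IsClosed (feasibleSet g) := by
  have : feasibleSet g = ⋂ i, {y | g i y ≤ 0} := by
    ext y
    simp [feasibleSet]
  rw [this]
  exact isClosed_iInter fun i => isClosed_le (hc i) continuous_const

/-- The common kernel at `x` of the derivatives of the constraints with index in `I`. -/
noncomputable def gradKernel (g : Fin l → Vec m → ℝ) (I : Finset (Fin l)) (x : Vec m) :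
    Submodule ℝ (Vec m) :=
  ⨅ i ∈ I, LinearMap.ker (fderiv ℝ (g i) x).toLinearMap

theorem mem_gradKernel {I : Finset (Fin l)} {x e : Vec m} :
    e ∈ gradKernel g I x ↔ ∀ i ∈ I, fderiv ℝ (g i) x e = 0 := by
  simp [gradKernel, Submodule.mem_iInf]

theorem gradKernel_eq_orthogonal (I : Finset (Fin l)) (x : Vec m) :
    gradKernel g I x = (Submodule.span ℝ ((fun i => ∇ (g i) x) '' (I : Set (Fin l))))ᗮ := by
  ext e
  rw [mem_gradKernel, Submodule.mem_orthogonal]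
  constructor
  · intro h u hu
    induction hu using Submodule.span_induction with
    | mem u hu =>
      obtain ⟨i, hi, rfl⟩ := hu
      exact inner_gradient_left.trans (h i hi)
    | zero => exact inner_zero_left _
    | add u v _ _ hu hv => rw [inner_add_left, hu, hv, add_zero]
    | smul c u _ hu => rw [real_inner_smul_left, hu, mul_zero]
  · exact fun h i hi => inner_gradient_left.symm.trans
      (h _ (Submodule.subset_span ⟨i, hi, rfl⟩))

theorem finrank_gradKernel (I : Finset (Fin l)) (x : Vec m) :
    Set.finrank ℝ ((fun i => ∇ (g i) x) '' (I : Set (Fin l))) +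
      Module.finrank ℝ (gradKernel g I x) = m := by
  rw [gradKernel_eq_orthogonal, Set.finrank, Submodule.finrank_add_finrank_orthogonal]
  simp

/-- Constant rank of all active gradients means kernels of constant dimension, and continuity of the
derivatives puts limits of kernel elements into `activeKernel`. -/
theorem CRCQ.exists_tendsto {ybar : Vec m} (h : CRCQ g ybar)
    (hsmooth : ∀ i, ContDiff ℝ 2 (g i)) {α : Type*} (u : Ultrafilter α) {x : α → Vec m}
    (hx : Tendsto x u (𝓝 ybar)) {e : Vec m} (he : e ∈ activeKernel g ybar) :
    ∃ f : α → Vec m, (∀ᶠ a in (u : Filter α), f a ∈ gradKernel g (active g ybar) (x a)) ∧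
      Tendsto f u (𝓝 e) := by
  refine exists_tendsto_of_finrank_eq u (E := gradKernel g (active g ybar) ybar) ?_ ?_ he
  · filter_upwards [hx.eventually (h _ subset_rfl)] with a ha
    have h1 := finrank_gradKernel (g := g) (active g ybar) (x a)
    have h2 := finrank_gradKernel (g := g) (active g ybar) ybar
    omega
  · intro b b₀ hb hlim
    rw [mem_gradKernel]
    intro i hi
    have hcont := ((hsmooth i).continuous_fderiv (by norm_num)).tendsto ybar
    refine tendsto_nhds_unique ((isBoundedBilinearMap_apply (𝕜 := ℝ)).continuous.tendsto _ |>.comp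
      ((hcont.comp hx).prodMk_nhds hlim))
      (tendsto_const_nhds.congr' (hb.mono fun a ha => ?_))
    exact (mem_gradKernel.1 ha i hi).symm

theorem HasDerivAt.eventually_nonpos_of_neg {φ : ℝ → ℝ} {φ' : ℝ} (h : HasDerivAt φ φ' 0)
    (hneg : φ' < 0) (h0 : φ 0 ≤ 0) : ∀ᶠ t in 𝓝[>] (0 : ℝ), φ t ≤ 0 := by
  have h1 := (hasDerivAt_iff_tendsto_slope.1 h).eventually (gt_mem_nhds hneg)
  have h2 : 𝓝[>] (0 : ℝ) ≤ 𝓝[≠] 0 := nhdsWithin_mono _ fun t ht => ne_of_gt ht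
  filter_upwards [h2 h1, self_mem_nhdsWithin] with t ht ht0
  have ht0' : (0 : ℝ) < t := ht0
  rw [slope_def_field, sub_zero, div_neg_iff] at ht
  rcases ht with ht | ht <;> linarith

/-- Under the Mangasarian-Fromovitz constraint qualification, normals at nearby points are
orthogonal to the common kernel of the derivatives of the active constraints. -/
theorem MFCQ.eventually_inner_eq_zero {ybar : Vec m} (h : MFCQ g ybar)
    (hy : ybar ∈ feasibleSet g) (hconv : ∀ i, ConvexOn ℝ univ (g i))
    (hsmooth : ∀ i, ContDiff ℝ 2 (g i)) :
    ∀ᶠ x in 𝓝 ybar, ∀ v ∈ regularNormalCone (feasibleSet g) x,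
      ∀ e ∈ gradKernel g (active g ybar) x, (inner ℝ v e : ℝ) = 0 := by
  obtain ⟨d, hd⟩ := h
  have hd' : ∀ᶠ x in 𝓝 ybar, ∀ i ∈ active g ybar, fderiv ℝ (g i) x d < 0 := by
    rw [Filter.eventually_all_finset]
    intro i hi
    have hc : Continuous fun x => fderiv ℝ (g i) x d :=
      ((hsmooth i).continuous_fderiv (by norm_num)).clm_apply continuous_const
    refine hc.tendsto ybar (gt_mem_nhds ?_)
    rw [← inner_gradient_left]
    exact hd i hi
  have hin : ∀ᶠ x in 𝓝 ybar, ∀ i, i ∉ active g ybar → g i x < 0 := by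
    rw [Filter.eventually_all]
    intro i
    by_cases hi : i ∈ active g ybar
    · exact Eventually.of_forall fun _ h => absurd hi h
    · have : g i ybar < 0 := lt_of_le_of_ne (hy i) fun h0 => hi (mem_active.2 h0)
      exact (((hsmooth i).continuous.tendsto ybar).eventually (gt_mem_nhds this)).mono
        fun _ h _ => h
  filter_upwards [hd', hin] with x hx1 hx2 v hv
  obtain ⟨hxA, hv⟩ := (mem_regularNormalCone_iff (convex_feasibleSet hconv)).1 hv
  have key : ∀ e ∈ gradKernel g (active g ybar) x, (inner ℝ v e : ℝ) ≤ 0 := by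
    intro e he
    -- Tilting `e` by `ε • d` makes all derivatives of constraints in `active g ybar` negative at
    -- `x`, so the direction is feasible for small steps. Then `ε → 0`.
    have hε : ∀ ε : ℝ, 0 < ε → (inner ℝ v (e + ε • d) : ℝ) ≤ 0 := by
      intro ε hε
      have hline : ∀ i, HasDerivAt (fun t : ℝ => g i (x + t • (e + ε • d)))
          (fderiv ℝ (g i) x (e + ε • d)) 0 := fun i => by
        have hl : HasDerivAt (fun t : ℝ => x + t • (e + ε • d)) (e + ε • d) 0 := by
          simpa using ((hasDerivAt_id (0 : ℝ)).smul_const (e + ε • d)).const_add x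
        refine HasFDerivAt.comp_hasDerivAt (0 : ℝ) ?_ hl
        rw [zero_smul, add_zero]
        exact ((hsmooth i).differentiable (by norm_num) x).hasFDerivAt
      have hfeas : ∀ᶠ t in 𝓝[>] (0 : ℝ), ∀ i, g i (x + t • (e + ε • d)) ≤ 0 := by
        rw [Filter.eventually_all]
        intro i
        by_cases hi : i ∈ active g ybar
        · refine HasDerivAt.eventually_nonpos_of_neg (hline i) ?_ ?_
          · rw [map_add, mem_gradKernel.1 he i hi, zero_add, map_smul, smul_eq_mul]
            exact mul_neg_of_pos_of_neg hε (hx1 i hi)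
          · simpa using hxA i
        · have := (hline i).continuousAt.tendsto
          rw [zero_smul, add_zero] at this
          exact ((this.eventually (gt_mem_nhds (hx2 i hi))).filter_mono nhdsWithin_le_nhds).mono
            fun _ h => le_of_lt h
      obtain ⟨t, ht, ht0⟩ := (hfeas.and self_mem_nhdsWithin).exists
      have ht0' : (0 : ℝ) < t := ht0
      have := hv _ ht
      rw [add_sub_cancel_left, real_inner_smul_right] at this
      exact nonpos_of_mul_nonpos_right this ht0'
    have hlim : Tendsto (fun ε : ℝ => (inner ℝ v (e + ε • d) : ℝ)) (𝓝[>] 0) (𝓝 (inner ℝ v e)) := by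
      have hc : Continuous fun ε : ℝ => (inner ℝ v (e + ε • d) : ℝ) := by fun_prop
      have := hc.tendsto 0
      rw [zero_smul, add_zero] at this
      exact this.mono_left nhdsWithin_le_nhds
    exact le_of_tendsto hlim (eventually_mem_nhdsWithin.mono hε)
  intro e he
  refine le_antisymm (key e he) ?_
  have := key (-e) (Submodule.neg_mem _ he)
  rw [inner_neg_right] at this
  linarith

/-! ### Hessians -/

theorem inner_toEuclideanLin_hessian (f : Vec m → ℝ) (y u w : Vec m) :
    (inner ℝ (Matrix.toEuclideanLin (hessian f y) u) w : ℝ) =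
      fderiv ℝ (fderiv ℝ f) y w u := by
  have hs : ∀ z : Vec m, z = ∑ i, z i • EuclideanSpace.single i (1 : ℝ) := fun z => by
    simpa [EuclideanSpace.basisFun_repr] using ((EuclideanSpace.basisFun (Fin m) ℝ).sum_repr z).symm
  conv_rhs => rw [hs w, hs u]
  simp only [map_sum, map_smul, FunLike.coe_sum, FunLike.coe_smul,
    Finset.sum_apply, Pi.smul_apply, smul_eq_mul, Finset.mul_sum]
  rw [Matrix.toLpLin_apply, PiLp.inner_apply, Finset.sum_comm]
  refine Finset.sum_congr rfl fun i _ => ?_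
  simp only [Matrix.mulVec, dotProduct, hessian, Matrix.of_apply, RCLike.inner_apply, conj_trivial]
  rw [Finset.mul_sum]
  exact Finset.sum_congr rfl fun j _ => by ring

theorem inner_toEuclideanLin_hessianSum (y : Vec m) (lam : Fin l → ℝ) (u w : Vec m) :
    (inner ℝ (Matrix.toEuclideanLin (hessianSum g y lam) u) w : ℝ) =
      ∑ i, lam i * fderiv ℝ (fderiv ℝ (g i)) y w u := by
  rw [hessianSum, map_sum, LinearMap.sum_apply, sum_inner]
  refine Finset.sum_congr rfl fun i _ => ?_
  rw [map_smul, LinearMap.smul_apply, real_inner_smul_left, inner_toEuclideanLin_hessian]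

theorem isSymmetric_hessianSum (hsmooth : ∀ i, ContDiff ℝ 2 (g i)) (y : Vec m)
    (lam : Fin l → ℝ) : (Matrix.toEuclideanLin (hessianSum g y lam)).IsSymmetric := by
  intro u w
  rw [real_inner_comm _ u, inner_toEuclideanLin_hessianSum, inner_toEuclideanLin_hessianSum]
  refine Finset.sum_congr rfl fun i _ => ?_
  rw [((hsmooth i).contDiffAt (x := y)).isSymmSndFDerivAt (by simp) w u]

/-! ### The tangent cone under strict complementarity. -/

theorem inner_sum_gradient (y e : Vec m) (lam : Fin l → ℝ) :
    (inner ℝ (∑ i, lam i • ∇ (g i) y) e : ℝ) = ∑ i, lam i * fderiv ℝ (g i) y e := by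
  rw [sum_inner]
  exact Finset.sum_congr rfl fun i _ => by rw [real_inner_smul_left, inner_gradient_left]

theorem sum_smul_gradient_mem_regularNormalCone (hconv : ∀ i, ConvexOn ℝ univ (g i))
    (hsmooth : ∀ i, ContDiff ℝ 2 (g i)) {y : Vec m} (hy : y ∈ feasibleSet g) {lam : Fin l → ℝ}
    (hlam : ∀ i, 0 ≤ lam i) (hcompl : ∀ i ∉ active g y, lam i = 0) :
    ∑ i, lam i • ∇ (g i) y ∈ regularNormalCone (feasibleSet g) y := by
  refine (mem_regularNormalCone_iff (convex_feasibleSet hconv)).2 ⟨hy, fun x hx => ?_⟩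
  rw [inner_sum_gradient]
  refine Finset.sum_nonpos fun i _ => ?_
  by_cases hi : i ∈ active g y
  · refine mul_nonpos_of_nonneg_of_nonpos (hlam i) ?_
    have h1 := fderiv_le_sub_of_convexOn (hconv i) ((hsmooth i).differentiable (by norm_num) y) x
    rw [mem_active.1 hi, sub_zero] at h1
    exact h1.trans (hx i)
  · rw [hcompl i hi, zero_mul]

/-- Under strict complementarity, tangents to the graph of the normal cone mapping have first
component in the common kernel of the derivatives of the active constraints. -/
theorem fst_mem_activeKernel_of_tangent (hconv : ∀ i, ConvexOn ℝ univ (g i))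
    (hsmooth : ∀ i, ContDiff ℝ 2 (g i)) {y : Vec m} (hy : y ∈ feasibleSet g) {lam : Fin l → ℝ}
    (hpos : ∀ i ∈ active g y, 0 < lam i) (hcompl : ∀ i ∉ active g y, lam i = 0) {q : Pair m m}
    (hq : q ∈ posTangentConeAt (gph (regularNormalCone (feasibleSet g)))
      (pair y (∑ i, lam i • ∇ (g i) y))) : q.fst ∈ activeKernel g y := by
  have hcv := convex_feasibleSet hconv
  have hlam : ∀ i, 0 ≤ lam i := fun i => by
    by_cases hi : i ∈ active g y
    · exact (hpos i hi).le
    · exact (hcompl i hi).ge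
  have hv := sum_smul_gradient_mem_regularNormalCone hconv hsmooth hy hlam hcompl
  set v := ∑ i, lam i • ∇ (g i) y with hvdef
  obtain ⟨-, hv⟩ := (mem_regularNormalCone_iff hcv).1 hv
  obtain ⟨α, f, hf, c, d, hd, hmem, hcd⟩ := exists_fun_of_mem_tangentConeAt hq
  have fstc : Continuous (WithLp.fst : Pair m m → Vec m) := by fun_prop
  have sndc : Continuous (WithLp.snd : Pair m m → Vec m) := by fun_prop
  have hcd1 : Tendsto (fun a => (c a : ℝ) • (d a).fst) f (𝓝 q.fst) := (fstc.tendsto q).comp hcd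
  have hd2 : Tendsto (fun a => (d a).snd) f (𝓝 0) := (sndc.tendsto 0).comp hd
  have hmem' : ∀ᶠ a in f, y + (d a).fst ∈ feasibleSet g ∧ ∀ x ∈ feasibleSet g,
      (inner ℝ (v + (d a).snd) (x - (y + (d a).fst)) : ℝ) ≤ 0 :=
    hmem.mono fun a ha => (mem_regularNormalCone_iff hcv).1 ha
  -- The normal inequality at the nearby graph point is tested with `y` itself. Together with `hle`,
  -- a nonnegative sum of nonpositive terms has all terms zero.
  have hge : 0 ≤ (inner ℝ v q.fst : ℝ) := by
    have h1 : Tendsto (fun a => (inner ℝ (v + (d a).snd) ((c a : ℝ) • (d a).fst) : ℝ)) f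
        (𝓝 (inner ℝ (v + 0) q.fst)) := (tendsto_const_nhds.add hd2).inner hcd1
    rw [add_zero] at h1
    refine ge_of_tendsto h1 (hmem'.mono fun a ha => ?_)
    have := ha.2 y hy
    rw [sub_add_cancel_left, inner_neg_right] at this
    rw [real_inner_smul_right]
    exact mul_nonneg (c a).2 (by linarith)
  have hle : ∀ i ∈ active g y, fderiv ℝ (g i) y q.fst ≤ 0 := fun i hi => by
    refine le_of_tendsto (((fderiv ℝ (g i) y).continuous.tendsto _).comp hcd1)
      (hmem'.mono fun a ha => ?_)
    have h1 := fderiv_le_sub_of_convexOn (hconv i) ((hsmooth i).differentiable (by norm_num) y)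
      (y + (d a).fst)
    rw [mem_active.1 hi, sub_zero, add_sub_cancel_left] at h1
    change fderiv ℝ (g i) y ((c a : ℝ) • (d a).fst) ≤ 0
    rw [map_smul, smul_eq_mul]
    exact mul_nonpos_of_nonneg_of_nonpos (c a).2 (h1.trans (ha.1 i))
  have hterm : ∀ i ∈ Finset.univ, lam i * fderiv ℝ (g i) y q.fst ≤ 0 := fun i _ => by
    by_cases hi : i ∈ active g y
    · exact mul_nonpos_of_nonneg_of_nonpos (hlam i) (hle i hi)
    · rw [hcompl i hi, zero_mul]
  rw [hvdef, inner_sum_gradient] at hge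
  have hz := (Finset.sum_eq_zero_iff_of_nonpos hterm).1
    (le_antisymm (Finset.sum_nonpos hterm) hge)
  refine mem_gradKernel.2 fun i hi => ?_
  exact (mul_eq_zero.1 (hz i (Finset.mem_univ i))).resolve_left (hpos i hi).ne'

/-- With `w → e` in the nearby kernels, `⟪v + δv, w⟫ = 0` expresses `⟪δv, w⟫` as `∑ lamᵢ (∇gᵢ(y +
δy) - ∇gᵢ(y)) w`. Scaling by `c` and passing to the limit yields `⟪k, e⟫ = ⟪A h, e⟫`. -/
theorem tangent_subset (hconv : ∀ i, ConvexOn ℝ univ (g i))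
    (hsmooth : ∀ i, ContDiff ℝ 2 (g i)) {y : Vec m} (hy : y ∈ feasibleSet g) (hMFCQ : MFCQ g y)
    (hCRCQ : CRCQ g y) {lam : Fin l → ℝ}
    (hpos : ∀ i ∈ active g y, 0 < lam i) (hcompl : ∀ i ∉ active g y, lam i = 0) {q : Pair m m}
    (hq : q ∈ posTangentConeAt (gph (regularNormalCone (feasibleSet g)))
      (pair y (∑ i, lam i • ∇ (g i) y))) :
    q ∈ (prodSubspace (activeKernel g y) (activeKernel g y)ᗮ).comap
      (shear (hessianSum g y lam)) := by
  refine mem_comap_shear.2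
    ⟨fst_mem_activeKernel_of_tangent hconv hsmooth hy hpos hcompl hq, fun e he => ?_⟩
  set v := ∑ i, lam i • ∇ (g i) y with hvdef
  obtain ⟨α, f₀, hf₀, c, d, hd₀, hmem₀, hcd₀⟩ := exists_fun_of_mem_tangentConeAt hq
  let f := Ultrafilter.of f₀
  have hf : (f : Filter α) ≤ f₀ := Ultrafilter.of_le f₀
  have hd := hd₀.mono_left hf
  have hcd := hcd₀.mono_left hf
  have hmem : ∀ᶠ a in (f : Filter α), v + (d a).snd ∈
      regularNormalCone (feasibleSet g) (y + (d a).fst) := hmem₀.filter_mono hf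
  have fstc : Continuous (WithLp.fst : Pair m m → Vec m) := by fun_prop
  have sndc : Continuous (WithLp.snd : Pair m m → Vec m) := by fun_prop
  have hcd1 : Tendsto (fun a => (c a : ℝ) • (d a).fst) f (𝓝 q.fst) := (fstc.tendsto q).comp hcd
  have hcd2 : Tendsto (fun a => (c a : ℝ) • (d a).snd) f (𝓝 q.snd) := (sndc.tendsto q).comp hcd
  have hd1 : Tendsto (fun a => (d a).fst) f (𝓝 0) := (fstc.tendsto 0).comp hd
  have hx : Tendsto (fun a => y + (d a).fst) f (𝓝 y) := by
    simpa using (tendsto_const_nhds (x := y)).add hd1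
  obtain ⟨w, hw, hwe⟩ := hCRCQ.exists_tendsto hsmooth f hx he
  have hzero : ∀ᶠ a in (f : Filter α), (inner ℝ (v + (d a).snd) (w a) : ℝ) = 0 := by
    filter_upwards [hx.eventually (hMFCQ.eventually_inner_eq_zero hy hconv hsmooth), hmem, hw]
      with a h1 h2 h3 using h1 _ h2 _ h3
  have hdiff : ∀ i, Tendsto (fun a => ((c a : ℝ) • (fderiv ℝ (g i) (y + (d a).fst) -
      fderiv ℝ (g i) y)) (w a)) f (𝓝 (fderiv ℝ (fderiv ℝ (g i)) y q.fst e)) := fun i => by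
    have h1 : DifferentiableAt ℝ (fderiv ℝ (g i)) y :=
      ((hsmooth i).fderiv_right (m := 1) (by norm_num)).differentiable (by norm_num) y
    have h2 := (h1.hasFDerivAt.hasFDerivWithinAt (s := univ)).lim hd1
      (Eventually.of_forall fun _ => mem_univ _) hcd1
    exact (isBoundedBilinearMap_apply (𝕜 := ℝ)).continuous.tendsto _ |>.comp (h2.prodMk_nhds hwe)
  have hsum := tendsto_finsetSum Finset.univ fun i _ => (hdiff i).const_mul (lam i)
  have heq : ∀ᶠ a in (f : Filter α), (inner ℝ ((c a : ℝ) • (d a).snd) (w a) : ℝ) =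
      ∑ i, lam i * ((c a : ℝ) • (fderiv ℝ (g i) (y + (d a).fst) - fderiv ℝ (g i) y)) (w a) := by
    filter_upwards [hzero, hw] with a h1 h2
    rw [inner_add_left, hvdef, inner_sum_gradient] at h1
    rw [real_inner_smul_left, eq_neg_of_add_eq_zero_right h1, ← Finset.sum_neg_distrib,
      Finset.mul_sum]
    refine Finset.sum_congr rfl fun i _ => ?_
    rw [smul_apply, sub_apply, smul_eq_mul]
    -- For active `i` the inserted term `∇gᵢ(y + δy) w` is zero because `w` lies in the nearby
    -- kernel; otherwise the multiplier vanishes.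
    by_cases hi : i ∈ active g y
    · rw [mem_gradKernel.1 h2 i hi]
      ring
    · rw [hcompl i hi]
      ring
  have hlim := tendsto_nhds_unique ((hcd2.inner hwe).congr' heq) hsum
  have hH := inner_toEuclideanLin_hessianSum (g := g) y lam q.fst e
  rw [real_inner_comm, inner_sub_left, hlim, hH, sub_eq_zero]
  refine Finset.sum_congr rfl fun i _ => ?_
  rw [((hsmooth i).contDiffAt (x := y)).isSymmSndFDerivAt (by simp) q.fst e]

/-- Under strict complementarity, the normal cone mapping is graphically smooth. -/
theorem isSmoothPoint_of_strictComplementarity (hconv : ∀ i, ConvexOn ℝ univ (g i))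
    (hsmooth : ∀ i, ContDiff ℝ 2 (g i)) {y : Vec m} (hy : y ∈ feasibleSet g) (hMFCQ : MFCQ g y)
    (hCRCQ : CRCQ g y) {lam : Fin l → ℝ}
    (hpos : ∀ i ∈ active g y, 0 < lam i) (hcompl : ∀ i ∉ active g y, lam i = 0) :
    IsSmoothPoint (regularNormalCone (feasibleSet g)) (pair y (∑ i, lam i • ∇ (g i) y))
      ((prodSubspace (activeKernel g y) (activeKernel g y)ᗮ).comap
        (shear (hessianSum g y lam))) := by
  have hcv := convex_feasibleSet hconv
  have hcl := isClosed_feasibleSet fun i => (hsmooth i).continuous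
  have hmem : pair y (∑ i, lam i • ∇ (g i) y) ∈ gph (regularNormalCone (feasibleSet g)) := by
    refine sum_smul_gradient_mem_regularNormalCone hconv hsmooth hy (fun i => ?_) hcompl
    by_cases hi : i ∈ active g y
    · exact (hpos i hi).le
    · exact (hcompl i hi).ge
  have hZ := comap_shear_mem_Z (hessianSum g y lam) (activeKernel g y)
  have hsub := fun q => tangent_subset (q := q) hconv hsmooth hy hMFCQ hCRCQ hpos hcompl
  refine ⟨hmem, hZ, Subset.antisymm hsub ?_⟩
  set T := (prodSubspace (activeKernel g y) (activeKernel g y)ᗮ).comap (shear (hessianSum g y lam))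
  obtain ⟨P, hP⟩ := exists_isProjOn ⟨y, hy⟩ hcl.isComplete hcv
  have htan : ∀ w : Vec m, ∃ h : Vec m, pair h (w - h) ∈ posTangentConeAt
      (gph (regularNormalCone (feasibleSet g))) (pair y (∑ i, lam i • ∇ (g i) y)) := fun w => by
    let u := Ultrafilter.of (𝓝[>] (0 : NNReal))
    have hu : (u : Filter NNReal) ≤ 𝓝[>] 0 := Ultrafilter.of_le _
    obtain ⟨h, -, hh⟩ := hP.exists_tangent hcv hmem u (t := id) (w := fun _ => w) (w₀ := w) (by
        have hc : Continuous fun a : NNReal => a • w := by fun_prop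
        have := hc.tendsto 0
        rw [zero_smul] at this
        exact this.mono_left (hu.trans nhdsWithin_le_nhds))
      ((eventually_mem_nhdsWithin.filter_mono hu).mono fun t ht => ne_of_gt ht)
      tendsto_const_nhds
    exact ⟨h, hh⟩
  -- The tangents found above lie in `T`, so `h + k` already takes every value on them; bijectivity
  -- on `T` then identifies any `q ∈ T` with such a tangent.
  have hsurj : Function.Surjective ((sumMap m).domRestrict T) := fun w => by
    obtain ⟨h, hh⟩ := htan w
    exact ⟨⟨_, hsub _ hh⟩, add_sub_cancel h w⟩
  have hinj : Function.Injective ((sumMap m).domRestrict T) :=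
    (LinearMap.injective_iff_surjective_of_finrank_eq_finrank
      (show Module.finrank ℝ T = Module.finrank ℝ (Vec m) by
        rw [show Module.finrank ℝ T = m from hZ]; simp)).2 hsurj
  intro q hq
  obtain ⟨h, hh⟩ := htan (q.fst + q.snd)
  have heq : (⟨q, hq⟩ : T) = ⟨_, hsub _ hh⟩ := hinj (add_sub_cancel h (q.fst + q.snd)).symm
  have heq' : q = pair h (q.fst + q.snd - h) := congrArg Subtype.val heq
  rwa [← heq'] at hh

/-! ### Perturbing the multiplier to strict complementarity. -/

theorem IsMultiplier.eq_zero_of_notMem_active {y v : Vec m} {lam : Fin l → ℝ}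
    (h : IsMultiplier g y v lam) (hy : y ∈ feasibleSet g) : ∀ i ∉ active g y, lam i = 0 := by
  intro i hi
  have hz := (Finset.sum_eq_zero_iff_of_nonpos (s := Finset.univ)
    (fun i _ => mul_nonpos_of_nonneg_of_nonpos (h.2.1 i) (hy i))).1 h.2.2 i (Finset.mem_univ i)
  exact (mul_eq_zero.1 hz).resolve_right fun h0 => hi (mem_active.2 h0)

theorem comap_shear_mem_SC (hconv : ∀ i, ConvexOn ℝ univ (g i))
    (hsmooth : ∀ i, ContDiff ℝ 2 (g i)) {y v : Vec m} (hy : y ∈ feasibleSet g) (hMFCQ : MFCQ g y)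
    (hCRCQ : CRCQ g y) {lam : Fin l → ℝ} (hlam : IsMultiplier g y v lam) :
    (prodSubspace (activeKernel g y) (activeKernel g y)ᗮ).comap (shear (hessianSum g y lam)) ∈
      SC (regularNormalCone (feasibleSet g)) y v := by
  classical
  let χ : Fin l → ℝ := fun i => if i ∈ active g y then 1 else 0
  let ε : ℕ → ℝ := fun k => 1 / ((k : ℝ) + 1)
  have hε : ∀ k, 0 < ε k := fun k => Nat.one_div_pos_of_nat
  have hε0 : Tendsto ε atTop (𝓝 0) := tendsto_one_div_add_atTop_nhds_zero_nat
  -- Only active entries are raised, so complementarity is kept and becomes strict; the Hessian sum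
  -- changes by `ε k` times a fixed matrix.
  let lamk : ℕ → Fin l → ℝ := fun k i => lam i + ε k * χ i
  have hcompl := hlam.eq_zero_of_notMem_active hy
  refine ⟨comap_shear_mem_Z _ _, fun k => pair y (∑ i, lamk k i • ∇ (g i) y),
    fun k => (prodSubspace (activeKernel g y) (activeKernel g y)ᗮ).comap
      (shear (hessianSum g y (lamk k))), fun k => ?_, ?_, ?_⟩
  · refine isSmoothPoint_of_strictComplementarity hconv hsmooth hy hMFCQ hCRCQ
      (fun i hi => ?_) fun i hi => ?_
    · simp only [lamk, χ, if_pos hi, mul_one]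
      exact add_pos_of_nonneg_of_pos (hlam.2.1 i) (hε k)
    · simp only [lamk, χ, if_neg hi, hcompl i hi, mul_zero, add_zero]
  · refine tendsto_pair tendsto_const_nhds ?_
    rw [hlam.1]
    refine tendsto_finsetSum _ fun i _ => Tendsto.smul_const ?_ _
    simpa using (hε0.mul_const (χ i)).const_add (lam i)
  · let H := LinearMap.toContinuousLinearMap (Matrix.toEuclideanLin (hessianSum g y χ))
    have hlim : Tendsto (fun k => 2 * (ε k * ‖H‖)) atTop (𝓝 0) := by
      simpa using (hε0.mul_const ‖H‖).const_mul 2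
    refine squeeze_zero (fun k => norm_nonneg _) (fun k => ?_) hlim
    refine subspaceDist_comap_shear_le _ _ _ _ (mul_nonneg (hε k).le (norm_nonneg _)) fun x => ?_
    have e : hessianSum g y (lamk k) = hessianSum g y lam + ε k • hessianSum g y χ := by
      simp only [hessianSum, lamk, Finset.smul_sum, ← Finset.sum_add_distrib, add_smul, mul_smul]
    rw [e, map_add, map_smul, LinearMap.add_apply, sub_add_cancel_left, norm_neg,
      LinearMap.smul_apply, norm_smul, Real.norm_of_nonneg (hε k).le, mul_assoc]
    exact mul_le_mul_of_nonneg_left (H.le_opNorm x) (hε k).le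

/-! ### QR factorizations with column pivoting -/

open Matrix in
/-- `(Q₁ ⋮ Q₂)` is orthogonal, in terms of its blocks. -/
theorem IsPivotedQR.blocks {m : ℕ} {ι : Type*} [Fintype ι] {D : Matrix (Fin m) ι ℝ} {s : ℕ}
    {Q₁ : Matrix (Fin m) (Fin s) ℝ} {Q₂ : Matrix (Fin m) (Fin (m - s)) ℝ}
    (h : IsPivotedQR D s Q₁ Q₂) :
    Q₁ᵀ * Q₁ = 1 ∧ Q₁ᵀ * Q₂ = 0 ∧ Q₂ᵀ * Q₁ = 0 ∧ Q₂ᵀ * Q₂ = 1 ∧ Q₁ * Q₁ᵀ + Q₂ * Q₂ᵀ = 1 := by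
  obtain ⟨-, h1, h2, -⟩ := h
  rw [transpose_fromCols, fromRows_mul_fromCols, ← fromBlocks_one, fromBlocks_inj] at h1
  rw [transpose_fromCols, fromCols_mul_fromRows] at h2
  exact ⟨h1.1, h1.2.1, h1.2.2.1, h1.2.2.2, h2⟩

open Matrix in
/-- The kernel of `Dᵀ` is the kernel of `Q₁ᵀ`. -/
theorem IsPivotedQR.transpose_mulVec_eq_zero_iff {m : ℕ} {ι : Type*} [Fintype ι]
    {D : Matrix (Fin m) ι ℝ} {s : ℕ} {Q₁ : Matrix (Fin m) (Fin s) ℝ}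
    {Q₂ : Matrix (Fin m) (Fin (m - s)) ℝ} (h : IsPivotedQR D s Q₁ Q₂) (x : Fin m → ℝ) :
    Dᵀ *ᵥ x = 0 ↔ Q₁ᵀ *ᵥ x = 0 := by
  obtain ⟨-, -, -, σ, R₁₁, R₁₂, -, hu, hD'⟩ := h
  have hD : D.submatrix id σ =
    (fromCols Q₁ Q₂ : Matrix (Fin m) (Fin s ⊕ Fin (m - s)) ℝ) *
      (fromBlocks R₁₁ R₁₂ 0 0 :
        Matrix (Fin s ⊕ Fin (m - s)) (Fin s ⊕ Fin (Fintype.card ι - s)) ℝ) := hD'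
  have e : (D.submatrix id σ)ᵀ *ᵥ x =
      Sum.elim (R₁₁ᵀ *ᵥ (Q₁ᵀ *ᵥ x)) (R₁₂ᵀ *ᵥ (Q₁ᵀ *ᵥ x)) := by
    rw [hD, transpose_mul, transpose_fromCols, fromBlocks_transpose, ← mulVec_mulVec,
      fromRows_mulVec, fromBlocks_mulVec]
    simp
  have e2 : (D.submatrix id σ)ᵀ *ᵥ x = (Dᵀ *ᵥ x) ∘ σ := rfl
  rw [e2] at e
  constructor
  · intro h0
    rw [h0] at e
    -- The first `s` pivot columns suffice, since `R₁₁ᵀ` is invertible.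
    have h1 : R₁₁ᵀ *ᵥ (Q₁ᵀ *ᵥ x) = 0 := by
      funext i
      exact (congrFun e (Sum.inl i)).symm
    have hu' : R₁₁ᵀ.det ≠ 0 := by rw [det_transpose]; exact hu.ne_zero
    exact eq_zero_of_mulVec_eq_zero hu' h1
  · intro h0
    rw [h0, mulVec_zero, mulVec_zero] at e
    funext i
    have := congrFun e (σ.symm i)
    rw [Function.comp_apply, Equiv.apply_symm_apply] at this
    rw [this]
    rcases σ.symm i with j | j <;> rfl

open Matrix in
theorem exists_isPivotedQR {m : ℕ} {ι : Type*} [Fintype ι] (D : Matrix (Fin m) ι ℝ) :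
    ∃ (s : ℕ) (Q₁ : Matrix (Fin m) (Fin s) ℝ) (Q₂ : Matrix (Fin m) (Fin (m - s)) ℝ),
      IsPivotedQR D s Q₁ Q₂ := by
  classical
  let c : ι → Vec m := fun i => WithLp.toLp 2 (D.col i)
  obtain ⟨κ, a, ha, hspan, hli⟩ := exists_linearIndependent' ℝ c
  have : Fintype κ := Fintype.ofInjective a ha
  have hrank : Fintype.card κ = D.rank := by
    have h1 := finrank_span_eq_card hli
    rw [hspan] at h1
    have h2 : Submodule.span ℝ (Set.range c) =
        (Submodule.span ℝ (Set.range D.col)).map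
          (WithLp.linearEquiv 2 ℝ (Fin m → ℝ)).symm.toLinearMap := by
      rw [Submodule.map_span, ← Set.range_comp]
      rfl
    rw [← h1, h2, LinearEquiv.finrank_map_eq, rank_eq_finrank_span_cols]
  have hsm : D.rank ≤ m := by simpa using D.rank_le_card_height
  set s := D.rank with hs
  let e : Fin s ≃ κ := (Fintype.equivFinOfCardEq hrank).symm
  have hinj : Function.Injective (a ∘ e) := ha.comp e.injective
  have hcard : Fintype.card ↥(Set.range (a ∘ e))ᶜ = Fintype.card ι - s := by
    rw [Fintype.card_compl_set, Set.card_range_of_injective hinj, Fintype.card_fin]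
  let σ : Fin s ⊕ Fin (Fintype.card ι - s) ≃ ι :=
    (Equiv.sumCongr (Equiv.ofInjective _ hinj) (Fintype.equivFinOfCardEq hcard).symm).trans
      (Equiv.Set.sumCompl _)
  have hσ : ∀ i, σ (Sum.inl i) = a (e i) := fun i => rfl
  have hli' : LinearIndependent ℝ fun i => c (σ (Sum.inl i)) := hli.comp e e.injective
  have hspan' : Submodule.span ℝ (Set.range fun i => c (σ (Sum.inl i))) =
      Submodule.span ℝ (Set.range c) := by
    rw [← hspan]
    congr 1
    exact e.surjective.range_comp (c ∘ a)
  -- The independent pivot columns, padded with zeros to `m` vectors so that Gram-Schmidt returns a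
  -- full orthonormal basis of the space.
  let f : Fin m → Vec m := fun k => if h : (k : ℕ) < s then c (σ (Sum.inl ⟨k, h⟩)) else 0
  obtain ⟨b, htri⟩ : ∃ b : OrthonormalBasis (Fin m) ℝ (Vec m),
      ∀ i j : Fin m, i < j → (inner ℝ (b j) (f i) : ℝ) = 0 :=
    ⟨InnerProductSpace.gramSchmidtOrthonormalBasis (by simp) f, fun i j hij =>
      InnerProductSpace.gramSchmidtOrthonormalBasis_inv_triangular _ f hij⟩
  let τ : Fin s ⊕ Fin (m - s) ≃ Fin m :=
    finSumFinEquiv.trans (finCongr (Nat.add_sub_cancel' hsm))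
  let B : Matrix (Fin m) (Fin m) ℝ := Matrix.of fun j k => b k j
  have hB1 : Bᵀ * B = 1 := by
    ext i j
    rw [mul_apply, one_apply, ← orthonormal_iff_ite.1 b.orthonormal i j, PiLp.inner_apply]
    exact Finset.sum_congr rfl fun k _ => mul_comm (b i k) (b j k)
  have hB2 : B * Bᵀ = 1 := mul_eq_one_comm.1 hB1
  let Q₁ : Matrix (Fin m) (Fin s) ℝ := Matrix.of fun j i => b (τ (Sum.inl i)) j
  let Q₂ : Matrix (Fin m) (Fin (m - s)) ℝ := Matrix.of fun j i => b (τ (Sum.inr i)) j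
  have hN : fromCols Q₁ Q₂ = B.submatrix id τ := by
    ext j k
    rcases k with k | k <;> rfl
  have hN1 : (fromCols Q₁ Q₂)ᵀ * fromCols Q₁ Q₂ = 1 := by
    rw [hN, transpose_submatrix]
    have := submatrix_mul_equiv Bᵀ B τ (Equiv.refl (Fin m)) τ
    rw [hB1, submatrix_one_equiv] at this
    exact this
  have hN2 : fromCols Q₁ Q₂ * (fromCols Q₁ Q₂)ᵀ = 1 := by
    rw [hN, transpose_submatrix, submatrix_mul_equiv, hB2]
    rfl
  let R := (fromCols Q₁ Q₂)ᵀ * D.submatrix id σ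
  have hR : ∀ i k, R i k = (inner ℝ (b (τ i)) (c (σ k)) : ℝ) := fun i k => by
    change ∑ j, (fromCols Q₁ Q₂)ᵀ i j * D.submatrix id σ j k = _
    rw [PiLp.inner_apply]
    refine Finset.sum_congr rfl fun j _ => ?_
    rcases i with i | i <;> exact mul_comm _ _
  have hf : ∀ i : Fin s, f (τ (Sum.inl i)) = c (σ (Sum.inl i)) := fun i => by
    have : (τ (Sum.inl i) : ℕ) = i := rfl
    simp only [f]
    rw [dif_pos (by rw [this]; exact i.2)]
    rfl
  have hR21 : ∀ i j, R (Sum.inr i) (Sum.inl j) = 0 := fun i j => by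
    rw [hR, ← hf]
    refine htri _ _ ?_
    have h1 : (τ (Sum.inl j) : ℕ) = j := rfl
    have h2 : (τ (Sum.inr i) : ℕ) = s + i := rfl
    rw [Fin.lt_def, h1, h2]
    omega
  -- The remaining columns lie in the span of the pivots, to which the columns of `Q₂` are
  -- orthogonal.
  have hR22 : ∀ i j, R (Sum.inr i) (Sum.inr j) = 0 := fun i j => by
    have hmem : c (σ (Sum.inr j)) ∈ Submodule.span ℝ (Set.range fun i => c (σ (Sum.inl i))) := by
      rw [hspan']
      exact Submodule.subset_span ⟨_, rfl⟩
    rw [hR]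
    generalize c (σ (Sum.inr j)) = u at hmem
    induction hmem using Submodule.span_induction with
    | mem u hu =>
      obtain ⟨k, rfl⟩ := hu
      exact (hR _ _).symm.trans (hR21 i k)
    | zero => exact inner_zero_right _
    | add u v _ _ hu hv => rw [inner_add_right, hu, hv, add_zero]
    | smul c u _ hu => rw [real_inner_smul_right, hu, mul_zero]
  have hRb : R = fromBlocks R.toBlocks₁₁ R.toBlocks₁₂ 0 0 := by
    ext i k
    rcases i with i | i <;> rcases k with k | k
    · rfl
    · rfl
    · exact hR21 i k
    · exact hR22 i k
  have hD : D.submatrix id σ = fromCols Q₁ Q₂ * R := by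
    rw [← Matrix.mul_assoc, hN2, Matrix.one_mul]
  refine ⟨s, Q₁, Q₂, hs, hN1, hN2, σ, R.toBlocks₁₁, R.toBlocks₁₂, fun i j hij => ?_, ?_, ?_⟩
  · change R (Sum.inl i) (Sum.inl j) = 0
    rw [hR, ← hf]
    exact htri _ _ hij
  · rw [isUnit_iff_ne_zero]
    intro hdet
    -- A kernel vector of `R₁₁` would be a linear relation among the pivot columns.
    obtain ⟨v, hv0, hv⟩ := exists_mulVec_eq_zero_iff.2 hdet
    refine hv0 ?_
    have h1 : D.submatrix id σ *ᵥ Sum.elim v 0 = 0 := by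
      rw [hD, ← mulVec_mulVec, hRb, fromBlocks_mulVec]
      simp [hv]
    refine funext (Fintype.linearIndependent_iff.1 hli' v ?_)
    ext j
    have h2 := congrFun h1 j
    simp only [mulVec, dotProduct, Fintype.sum_sum_type, Sum.elim_inl, Sum.elim_inr,
      Pi.zero_apply, mul_zero, Finset.sum_const_zero, add_zero, submatrix_apply, id] at h2
    simpa [c, mul_comm] using h2
  · rw [← hRb]
    exact hD

open Matrix in
theorem ofLp_sub_toEuclideanLin (A : Matrix (Fin m) (Fin m) ℝ) (u v : Vec m) :
    (v - Matrix.toEuclideanLin A u).ofLp = v.ofLp - A *ᵥ u.ofLp := rfl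

theorem MFCQ.gradient_ne_zero {y : Vec m} (h : MFCQ g y) {i : Fin l} (hi : i ∈ active g y) :
    ∇ (g i) y ≠ 0 := fun h0 => by
  obtain ⟨d, hd⟩ := h
  have := hd i hi
  rw [h0, inner_zero_left] at this
  exact lt_irrefl _ this

open Matrix in
-- MFCQ makes active gradients nonzero, so normalizing the columns does not change the kernel.
theorem mem_activeKernel_iff_transpose_mulVec {y : Vec m} (h : MFCQ g y) (x : Vec m) :
    x ∈ activeKernel g y ↔ (activeMatrix g y)ᵀ *ᵥ x.ofLp = 0 := by
  have e : ∀ i : active g y, ((activeMatrix g y)ᵀ *ᵥ x.ofLp) i =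
      fderiv ℝ (g i) y x / ‖∇ (g i) y‖ := fun i => by
    change ∑ j, (activeMatrix g y)ᵀ i j * x.ofLp j = _
    rw [← inner_gradient_left, PiLp.inner_apply, Finset.sum_div]
    refine Finset.sum_congr rfl fun j _ => ?_
    simp only [activeMatrix, transpose_apply, of_apply, RCLike.inner_apply, conj_trivial]
    ring
  constructor
  · intro hx
    funext i
    rw [e, mem_gradKernel.1 hx i i.2, zero_div]
    rfl
  · intro hx
    refine mem_gradKernel.2 fun i hi => ?_
    have := (e ⟨i, hi⟩).symm.trans (congrFun hx ⟨i, hi⟩)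
    exact (div_eq_zero_iff.1 this).resolve_right (norm_ne_zero_iff.2 (h.gradient_ne_zero hi))

open Matrix in
theorem IsPivotedQR.mem_activeKernel_iff {y : Vec m} (h : MFCQ g y) {s : ℕ}
    {Q₁ : Matrix (Fin m) (Fin s) ℝ} {Q₂ : Matrix (Fin m) (Fin (m - s)) ℝ}
    (hQ : IsPivotedQR (activeMatrix g y) s Q₁ Q₂) (x : Vec m) :
    x ∈ activeKernel g y ↔ ∃ a, x.ofLp = Q₂ *ᵥ a := by
  obtain ⟨-, h12, -, -, hsum⟩ := hQ.blocks
  rw [mem_activeKernel_iff_transpose_mulVec h, hQ.transpose_mulVec_eq_zero_iff]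
  constructor
  · intro hx
    refine ⟨Q₂ᵀ *ᵥ x.ofLp, ?_⟩
    conv_lhs => rw [← one_mulVec x.ofLp, ← hsum, add_mulVec, ← mulVec_mulVec, hx, mulVec_zero,
      zero_add, ← mulVec_mulVec]
  · rintro ⟨a, ha⟩
    rw [ha, mulVec_mulVec, h12, zero_mulVec]

open Matrix in
theorem IsPivotedQR.mem_activeKernel_orthogonal_iff {y : Vec m} (h : MFCQ g y) {s : ℕ}
    {Q₁ : Matrix (Fin m) (Fin s) ℝ} {Q₂ : Matrix (Fin m) (Fin (m - s)) ℝ}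
    (hQ : IsPivotedQR (activeMatrix g y) s Q₁ Q₂) (x : Vec m) :
    x ∈ (activeKernel g y)ᗮ ↔ ∃ b, x.ofLp = Q₁ *ᵥ b := by
  obtain ⟨-, -, h21, -, hsum⟩ := hQ.blocks
  have hin : ∀ a, (inner ℝ (WithLp.toLp 2 (Q₂ *ᵥ a) : Vec m) x : ℝ) = (Q₂ᵀ *ᵥ x.ofLp) ⬝ᵥ a :=
    fun a => by
      rw [EuclideanSpace.inner_eq_star_dotProduct, star_trivial, dotProduct_mulVec,
        mulVec_transpose]
  have hx : x ∈ (activeKernel g y)ᗮ ↔ Q₂ᵀ *ᵥ x.ofLp = 0 := by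
    constructor
    · intro hx
      have := hx (WithLp.toLp 2 (Q₂ *ᵥ (Q₂ᵀ *ᵥ x.ofLp)))
        ((hQ.mem_activeKernel_iff h _).2 ⟨_, rfl⟩)
      rw [hin] at this
      exact dotProduct_self_eq_zero.1 this
    · intro hx u hu
      obtain ⟨a, ha⟩ := (hQ.mem_activeKernel_iff h _).1 hu
      have hu' : u = WithLp.toLp 2 (Q₂ *ᵥ a) := WithLp.ofLp_injective 2 ha
      rw [hu', hin, hx, zero_dotProduct]
  rw [hx]
  constructor
  · intro hx
    refine ⟨Q₁ᵀ *ᵥ x.ofLp, ?_⟩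
    conv_lhs => rw [← one_mulVec x.ofLp, ← hsum, add_mulVec, ← mulVec_mulVec, ← mulVec_mulVec, hx,
      mulVec_zero, add_zero]
  · rintro ⟨b, hb⟩
    rw [hb, mulVec_mulVec, h21, zero_mulVec]

open Matrix in
-- Elements have `h = Q₂ a` and `k - A h = Q₁ b`; the coordinates `a`, `b` are recovered by `Q₂ᵀ`
-- and `Q₁ᵀ`.
theorem IsPivotedQR.isBasisOf {y : Vec m} (h : MFCQ g y) {s : ℕ}
    {Q₁ : Matrix (Fin m) (Fin s) ℝ} {Q₂ : Matrix (Fin m) (Fin (m - s)) ℝ}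
    (hQ : IsPivotedQR (activeMatrix g y) s Q₁ Q₂) (A : Matrix (Fin m) (Fin m) ℝ) :
    IsBasisOf (fromCols Q₂ (0 : Matrix (Fin m) (Fin s) ℝ)) (fromCols (A * Q₂) Q₁)
      ((prodSubspace (activeKernel g y) (activeKernel g y)ᗮ).comap (shear A)) := by
  obtain ⟨h11, -, -, h22, -⟩ := hQ.blocks
  have hfst : ∀ p, (stackMap (fromCols Q₂ (0 : Matrix (Fin m) (Fin s) ℝ))
      (fromCols (A * Q₂) Q₁) p).fst.ofLp = Q₂ *ᵥ (p.ofLp ∘ Sum.inl) := fun p => by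
    change fromCols Q₂ (0 : Matrix (Fin m) (Fin s) ℝ) *ᵥ p.ofLp = _
    rw [fromCols_mulVec, zero_mulVec, add_zero]
  have hsnd : ∀ p, (stackMap (fromCols Q₂ (0 : Matrix (Fin m) (Fin s) ℝ))
      (fromCols (A * Q₂) Q₁) p).snd.ofLp =
      A *ᵥ (Q₂ *ᵥ (p.ofLp ∘ Sum.inl)) + Q₁ *ᵥ (p.ofLp ∘ Sum.inr) := fun p => by
    change fromCols (A * Q₂) Q₁ *ᵥ p.ofLp = _
    rw [fromCols_mulVec, mulVec_mulVec]
  refine ⟨?_, ?_, ?_⟩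
  · have : s ≤ m := by
      rw [hQ.1]
      simpa using (activeMatrix g y).rank_le_card_height
    rw [Fintype.card_sum, Fintype.card_fin, Fintype.card_fin]
    omega
  · rw [← LinearMap.ker_eq_bot, LinearMap.ker_eq_bot']
    intro p hp
    have h1 := hfst p
    have h2 := hsnd p
    rw [hp] at h1 h2
    have h1' : Q₂ *ᵥ (p.ofLp ∘ Sum.inl) = 0 := h1.symm
    rw [h1', mulVec_zero, zero_add] at h2
    have h2' : Q₁ *ᵥ (p.ofLp ∘ Sum.inr) = 0 := h2.symm
    have k1 : p.ofLp ∘ Sum.inl = 0 := by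
      rw [← one_mulVec (p.ofLp ∘ Sum.inl), ← h22, ← mulVec_mulVec, h1', mulVec_zero]
    have k2 : p.ofLp ∘ Sum.inr = 0 := by
      rw [← one_mulVec (p.ofLp ∘ Sum.inr), ← h11, ← mulVec_mulVec, h2', mulVec_zero]
    ext i
    rcases i with i | i
    · exact congrFun k1 i
    · exact congrFun k2 i
  · ext q
    rw [mem_comap_shear, hQ.mem_activeKernel_iff h, hQ.mem_activeKernel_orthogonal_iff h]
    constructor
    · rintro ⟨⟨a, ha⟩, b, hb⟩
      refine ⟨WithLp.toLp 2 (Sum.elim a b), WithLp.ofLp_injective 2 (Prod.ext ?_ ?_)⟩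
      · refine WithLp.ofLp_injective 2 ((hfst _).trans ?_)
        exact ha.symm
      · refine WithLp.ofLp_injective 2 ((hsnd _).trans ?_)
        have hb' : q.snd.ofLp - A *ᵥ q.fst.ofLp = Q₁ *ᵥ b := hb
        rw [ha] at hb'
        exact (sub_eq_iff_eq_add'.1 hb').symm
    · rintro ⟨p, rfl⟩
      refine ⟨⟨_, hfst p⟩, p.ofLp ∘ Sum.inr, ?_⟩
      rw [ofLp_sub_toEuclideanLin, hsnd, hfst, add_sub_cancel_left]

theorem comap_shear_zero (M : Submodule ℝ (Pair m m)) : M.comap (shear 0) = M := by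
  have : shear (0 : Matrix (Fin m) (Fin m) ℝ) = LinearMap.id := by
    refine LinearMap.ext fun p => WithLp.ofLp_injective 2 (Prod.ext rfl ?_)
    change p.snd - Matrix.toEuclideanLin 0 p.fst = p.snd
    rw [map_zero, LinearMap.zero_apply, sub_zero]
  rw [this, Submodule.comap_id]

end SCD

theorem mainTheorem2 {m l : ℕ} (g : Fin l → SCD.Vec m → ℝ)
    (hconv : ∀ i, ConvexOn ℝ Set.univ (g i)) (hsmooth : ∀ i, ContDiff ℝ 2 (g i))
    (Q : SCD.Vec m → Set (SCD.Vec m)) (hQ : Q = SCD.regularNormalCone (SCD.feasibleSet g))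
    (ybar ystar : SCD.Vec m) (hystar : ystar ∈ Q ybar)
    (hMFCQ : SCD.MFCQ g ybar) (hCRCQ : SCD.CRCQ g ybar)
    (lam : Fin l → ℝ) (hlam : SCD.IsMultiplier g ybar ystar lam)
    (A : Matrix (Fin m) (Fin m) ℝ) (hA : A = SCD.hessianSum g ybar lam)
    (E : Submodule ℝ (SCD.Vec m)) (hE : E = SCD.activeKernel g ybar)
    (M : Submodule ℝ (SCD.Pair m m)) (hM : M = SCD.prodSubspace E Eᗮ)
    (L : Submodule ℝ (SCD.Pair m m)) (hL : L = M.comap (SCD.shear A)) :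
    M ∈ SCD.Z m m ∧
    L = SCD.adjoint L ∧
    L ∈ SCD.SC Q ybar ystar ∧
    SCD.SC Q ybar ystar = SCD.SCstar Q ybar ystar ∧
    (∃ (s : ℕ) (Q₁ : Matrix (Fin m) (Fin s) ℝ) (Q₂ : Matrix (Fin m) (Fin (m - s)) ℝ),
      SCD.IsPivotedQR (SCD.activeMatrix g ybar) s Q₁ Q₂) ∧
    (∀ (s : ℕ) (Q₁ : Matrix (Fin m) (Fin s) ℝ) (Q₂ : Matrix (Fin m) (Fin (m - s)) ℝ),
      SCD.IsPivotedQR (SCD.activeMatrix g ybar) s Q₁ Q₂ →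
        SCD.IsBasisOf (Matrix.fromCols Q₂ (0 : Matrix (Fin m) (Fin s) ℝ))
          (Matrix.fromCols (0 : Matrix (Fin m) (Fin (m - s)) ℝ) Q₁) M ∧
        SCD.IsBasisOf (Matrix.fromCols Q₂ (0 : Matrix (Fin m) (Fin s) ℝ))
          (Matrix.fromCols (A * Q₂) Q₁) (SCD.adjoint L)) := by

  subst hQ hE hM hL hA
  have hy : ybar ∈ SCD.feasibleSet g := hystar.1
  have hcv := SCD.convex_feasibleSet hconv
  have hcl := SCD.isClosed_feasibleSet fun i => (hsmooth i).continuous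
  have hadj := (SCD.isIsotropic_comap_shear
    (SCD.isSymmetric_hessianSum hsmooth ybar lam) (SCD.activeKernel g ybar)).eq_adjoint
    (SCD.comap_shear_mem_Z _ _)
  refine ⟨SCD.prodSubspace_orthogonal_mem_Z _, hadj,
    SCD.comap_shear_mem_SC hconv hsmooth hy hMFCQ hCRCQ hlam,
    SCD.SC_eq_SCstar hcv hcl ybar ystar, SCD.exists_isPivotedQR _, fun s Q₁ Q₂ hQ => ⟨?_, ?_⟩⟩
  -- The basis of `M` is the case of zero Hessian, where the shear is the identity.
  · have := hQ.isBasisOf hMFCQ 0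
    rwa [SCD.comap_shear_zero, Matrix.zero_mul] at this
  · rw [← hadj]
    exact hQ.isBasisOf hMFCQ _
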